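/- Let $K$ be a field of characteristic different from $2$ and $3$. Algebras are not assumed to be associative or to have a unit; for an element $x$ of a commutative algebra, $L_x$ denotes the operator of multiplication by $x$ and $x^3=(xx)x$. An algebra is nilpotent of index $m$ if $m$ is the least positive integer such that every product of $m$ or more elements (with any bracketing) is zero, and it is locally nilpotent if each of its finitely generated subalgebras is nilpotent. (1) Every commutative $K$-algebra satisfying the identity $L_x^3=\tfrac12 L_{x^3}$ is locally nilpotent. (2) More precisely, let $k\ge 0$ be an integer. The free commutative $K$-algebra on $k$ generators satisfying the identity $x^3=0$ is nilpotent; let $n$ be its index of nilpotency. Let $\dim[n,k]$ be the dimension of the subspace of the free commutative (nonassociative, non-unital) $K$-algebra on $k$ generators that is spanned by the monomials of degree less than $n$, that is, the number of commutative nonassociative monomials of degree less than $n$ in $k$ variables. Then every commutative $K$-algebra that is generated by $k$ elements and satisfies $L_x^3=\tfrac12 L_{x^3}$ is nilpotent of index at most $2^{4n\dim[n,k]}$. -/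

import Mathlib

universe u v w

/-! ### Nilpotency of algebras that need not be associative -/

/-- Every product of at least `m` factors from `A`, with any arrangement of brackets, is zero. -/
def ProductsVanish (A : Type u) [Mul A] [Zero A] (m : ℕ) : Prop :=
  ∀ p : FreeMagma A, m ≤ p.length → FreeMagma.lift (id : A → A) p = 0

/-- `m` is the index of nilpotency of `A`: the least positive integer such that all products of
`m` or more factors vanish. -/
def IsNilpotencyIndex (A : Type u) [Mul A] [Zero A] (m : ℕ) : Prop :=
  IsLeast {j : ℕ | 1 ≤ j ∧ ProductsVanish A j} m

/-- `A` is nilpotent. -/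
def IsNilpotentAlgebra (A : Type u) [Mul A] [Zero A] : Prop :=
  ∃ m : ℕ, IsNilpotencyIndex A m

/-- `A` is locally nilpotent: every finitely generated subalgebra is nilpotent. -/
def IsLocallyNilpotentAlgebra (K : Type u) (A : Type v) [Field K] [NonUnitalNonAssocCommRing A]
    [Module K A] [IsScalarTower K A A] [SMulCommClass K A A] : Prop :=
  ∀ s : Finset A, IsNilpotentAlgebra (NonUnitalAlgebra.adjoin K (s : Set A))

/-- `A` is generated, as a non-unital algebra over `K`, by `k` elements. -/
def IsGeneratedBy (K : Type u) (A : Type v) [Field K] [NonUnitalNonAssocCommRing A]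
    [Module K A] [IsScalarTower K A A] [SMulCommClass K A A] (k : ℕ) : Prop :=
  ∃ g : Fin k → A, NonUnitalAlgebra.adjoin K (Set.range g) = ⊤

/-- The identity `L_x ^ 3 = (1 / 2) L_{x ^ 3}` between operators on `A`, where `L_x` is left
multiplication by `x`. -/
def SatisfiesHalfCubeIdentity (K : Type u) (A : Type v) [Field K] [NonUnitalNonAssocCommRing A]
    [Module K A] [IsScalarTower K A A] [SMulCommClass K A A] : Prop :=
  ∀ x : A, LinearMap.mulLeft K x ^ 3 = (1 / 2 : K) • LinearMap.mulLeft K (x * x * x)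

/-! ### The free commutative algebra -/

/-- The multiplicative congruence on nonassociative words generated by commutativity. -/
def commCon (X : Type u) : Con (FreeMagma X) :=
  conGen fun a b => ∃ p q : FreeMagma X, a = p * q ∧ b = q * p

/-- The commutative nonassociative monomials (of degree at least one) in the variables `X`. -/
def CommMonomial (X : Type u) : Type u := (commCon X).Quotient

instance CommMonomial.instCommMagma (X : Type u) : CommMagma (CommMonomial X) where
  mul := ((inferInstance : Mul (commCon X).Quotient)).mul
  mul_comm a b := by
    induction a using Con.induction_on with
    | H p =>
      induction b using Con.induction_on with
      | H q => exact (Con.eq (commCon X)).2 (ConGen.Rel.of _ _ ⟨p, q, rfl, rfl⟩)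

theorem commCon_length {X : Type u} {p q : FreeMagma X} (h : commCon X p q) :
    p.length = q.length := by
  have h' : ConGen.Rel (fun a b => ∃ p q : FreeMagma X, a = p * q ∧ b = q * p) p q := h
  induction h' with
  | of a b hab =>
    obtain ⟨p, q, rfl, rfl⟩ := hab
    exact Nat.add_comm p.length q.length
  | refl a => rfl
  | symm _ ih => exact (ih ‹_›).symm
  | trans _ _ ih₁ ih₂ => exact (ih₁ ‹_›).trans (ih₂ ‹_›)
  | mul _ _ ih₁ ih₂ => exact congrArg₂ (· + ·) (ih₁ ‹_›) (ih₂ ‹_›)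

/-- The degree of a monomial: its number of factors from `X`. -/
def CommMonomial.degree {X : Type u} (m : CommMonomial X) : ℕ :=
  Con.liftOn m FreeMagma.length fun _ _ h => commCon_length h

/-- The free commutative (nonassociative, non-unital) `K`-algebra on `X`: the vector space with
basis the commutative monomials, multiplied bilinearly. -/
abbrev FreeCommAlgebra (K : Type u) (X : Type v) [Field K] : Type (max u v) :=
  MonoidAlgebra K (CommMonomial X)

/-- `dim[n,k]`: the dimension of the subspace of the free commutative algebra on `k` generators
that is spanned by the monomials of degree less than `n`. -/
noncomputable def dimBelow (K : Type u) [Field K] (n k : ℕ) : ℕ :=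
  Module.finrank K (Submodule.span K
    ((fun m : CommMonomial (Fin k) => (MonoidAlgebra.single m 1 : FreeCommAlgebra K (Fin k))) ''
      {m | m.degree < n}))

/-! ### The free commutative algebra with `x ^ 3 = 0` -/

theorem FreeCommAlgebra.mul_comm' {K : Type u} {X : Type v} [Field K]
    (a b : FreeCommAlgebra K X) : a * b = b * a := by
  induction a using MonoidAlgebra.induction_linear with
  | zero => simp
  | add a₁ a₂ h₁ h₂ => rw [add_mul, mul_add, h₁, h₂]
  | single m r =>
    induction b using MonoidAlgebra.induction_linear with
    | zero => simp
    | add b₁ b₂ h₁ h₂ => rw [add_mul, mul_add, h₁, h₂]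
    | single n s =>
      rw [MonoidAlgebra.single_mul_single, MonoidAlgebra.single_mul_single, mul_comm m n,
        mul_comm r s]

/-- The ideal of the free commutative algebra generated by all cubes `(x x) x`: the smallest
subspace that contains them and is closed under multiplication by arbitrary elements. -/
noncomputable def cubeIdeal (K : Type u) (X : Type v) [Field K] : Submodule K (FreeCommAlgebra K X) :=
  sInf {I | (∀ a x, x ∈ I → a * x ∈ I) ∧ ∀ x : FreeCommAlgebra K X, x * x * x ∈ I}

theorem mul_mem_cubeIdeal {K : Type u} {X : Type v} [Field K] (a : FreeCommAlgebra K X)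
    {x : FreeCommAlgebra K X} (hx : x ∈ cubeIdeal K X) : a * x ∈ cubeIdeal K X :=
  Submodule.mem_sInf.2 fun I hI => hI.1 a x (Submodule.mem_sInf.1 hx I hI)

/-- The free commutative `K`-algebra on `X` satisfying the identity `x ^ 3 = 0`. -/
abbrev FreeCubeZeroAlgebra (K : Type u) (X : Type v) [Field K] : Type (max u v) :=
  FreeCommAlgebra K X ⧸ cubeIdeal K X

namespace FreeCubeZeroAlgebra

variable {K : Type u} {X : Type v} [Field K]

noncomputable instance instMul : Mul (FreeCubeZeroAlgebra K X) where
  mul := Quotient.map₂ (· * ·) fun a₁ a₂ ha b₁ b₂ hb => by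
    replace ha := (Submodule.quotientRel_def _).1 ha
    replace hb := (Submodule.quotientRel_def _).1 hb
    refine (Submodule.quotientRel_def _).2 ?_
    have h : a₁ * b₁ - a₂ * b₂ = b₁ * (a₁ - a₂) + a₂ * (b₁ - b₂) := by
      rw [mul_sub, mul_sub, FreeCommAlgebra.mul_comm' b₁ a₁, FreeCommAlgebra.mul_comm' b₁ a₂]
      abel
    rw [h]
    exact add_mem (mul_mem_cubeIdeal _ ha) (mul_mem_cubeIdeal _ hb)

theorem mk_mul (a b : FreeCommAlgebra K X) :
    (Submodule.Quotient.mk (a * b) : FreeCubeZeroAlgebra K X) =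
      Submodule.Quotient.mk a * Submodule.Quotient.mk b := rfl

noncomputable instance instNonUnitalNonAssocCommRing :
    NonUnitalNonAssocCommRing (FreeCubeZeroAlgebra K X) where
  __ := (inferInstance : AddCommGroup (FreeCubeZeroAlgebra K X))
  __ := instMul
  left_distrib := by
    rintro ⟨a⟩ ⟨b⟩ ⟨c⟩
    exact congrArg Submodule.Quotient.mk (mul_add a b c)
  right_distrib := by
    rintro ⟨a⟩ ⟨b⟩ ⟨c⟩
    exact congrArg Submodule.Quotient.mk (add_mul a b c)
  zero_mul := by
    rintro ⟨a⟩
    exact congrArg Submodule.Quotient.mk (zero_mul a)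
  mul_zero := by
    rintro ⟨a⟩
    exact congrArg Submodule.Quotient.mk (mul_zero a)
  mul_comm := by
    rintro ⟨a⟩ ⟨b⟩
    exact congrArg Submodule.Quotient.mk (FreeCommAlgebra.mul_comm' a b)

instance instIsScalarTower :
    IsScalarTower K (FreeCubeZeroAlgebra K X) (FreeCubeZeroAlgebra K X) where
  smul_assoc := by
    rintro r ⟨a⟩ ⟨b⟩
    exact congrArg Submodule.Quotient.mk (smul_mul_assoc r a b)

instance instSMulCommClass :
    SMulCommClass K (FreeCubeZeroAlgebra K X) (FreeCubeZeroAlgebra K X) where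
  smul_comm := by
    rintro r ⟨a⟩ ⟨b⟩
    exact congrArg Submodule.Quotient.mk (mul_smul_comm r a b).symm

end FreeCubeZeroAlgebra

/-! Let `C` be the span of the cubes of `A`. Linearizing the identity shows that `C` is an ideal
(`mul_mem_cubeSpan`) with `C * C = 0` (`cubeSpan_mul_cubeSpan`), and cubes vanish modulo `C`. If the
free algebra with `x ^ 3 = 0` has nilpotency index `n`, every monomial of degree at least `n`
therefore takes values in `C` (`eval_mem_cubeSpan`).

Regard the operators `L_m`, for monomials `m` in the generators, as letters. Modulo shorter words of
no smaller degree, three letters satisfy a homogeneous cubic relation (`mul_mul_eq_of_halfCube`). It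
follows that a word in which some letter occurs three times can be shortened without loss of degree
(`ReducesTriples.three_occurrences`). Only `D = dim[n,k]` letters have degree below `n`, so a word
of degree at least `2nD` reduces to words containing a letter of degree at least `n`
(`ReducesTriples.word_mem`). Such words map `A` into `C` and kill `C`, hence two of them compose to
zero. A product of `2 ^ (4nD)` factors contains a word of `4nD` operators, because at each bracket
one may descend into the longer factor.

The existence of `n` is a separate matter. If `x ^ 3 = 0` holds, then `L_{xy} = -(L_x L_y + L_y
L_x)`, and symmetrized products of three multiplication operators vanish. An explicit certificate
gives `[[x², y²], z² ∘ t²] = 0` for such operators, and from it the fourth derived term annihilates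
the algebra (`derivedSubspace_four_le`). An elimination procedure with `L_a ^ 3 = 0` then climbs
back along the derived series: finitely many operators generate only finitely many nonzero words
(`wordsVanish_of_finite`), and nilpotency follows. -/

/-! ### Words in four elements of a special Jordan family with vanishing cubes -/

namespace FourLetters

/-- Four letters. -/
inductive Letter
  | x | y | z | t

/-- Iterated Jordan products `a ∘ b = a b + b a` of the letters. -/
inductive Jordan
  | of : Letter → Jordan
  | mul : Jordan → Jordan → Jordan

instance : Coe Letter Jordan := ⟨Jordan.of⟩

local infixl:70 " ⋄ " => Jordan.mul

/-- Integer combinations of words in the letters, stored as a trie: `node c p q r s` is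
`c + x p + y q + z r + t s`. -/
inductive Trie
  | nil : Trie
  | node : ℤ → Trie → Trie → Trie → Trie → Trie

namespace Trie

/-- Addition of polynomials. -/
def add : Trie → Trie → Trie
  | nil, q => q
  | p, nil => p
  | node c a₁ a₂ a₃ a₄, node d b₁ b₂ b₃ b₄ =>
    node (c + d) (add a₁ b₁) (add a₂ b₂) (add a₃ b₃) (add a₄ b₄)

/-- Does the polynomial have only zero coefficients? -/
def isZero : Trie → Bool
  | nil => true
  | node c a₁ a₂ a₃ a₄ => decide (c = 0) && a₁.isZero && a₂.isZero && a₃.isZero && a₄.isZero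

/-- Left multiplication by a letter. -/
def letter : Letter → Trie → Trie
  | .x, p => node 0 p nil nil nil
  | .y, p => node 0 nil p nil nil
  | .z, p => node 0 nil nil p nil
  | .t, p => node 0 nil nil nil p

/-- Left multiplication by an iterated Jordan product. -/
def jordan : Jordan → Trie → Trie
  | .of i, p => letter i p
  | .mul a b, p => add (jordan a (jordan b p)) (jordan b (jordan a p))

/-- Left multiplication by a word. -/
def word : List Letter → Trie → Trie
  | [], p => p
  | i :: l, p => letter i (word l p)

/-- Left multiplication by the symmetrization of the product of three Jordan elements. -/
def sym (a b c : Jordan) (p : Trie) : Trie :=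
  add (add (jordan a (add (jordan b (jordan c p)) (jordan c (jordan b p))))
    (jordan b (add (jordan c (jordan a p)) (jordan a (jordan c p)))))
    (jordan c (add (jordan a (jordan b p)) (jordan b (jordan a p))))

/-- The value of a polynomial at four elements of a ring. -/
def eval {R : Type*} [Ring R] (f : Letter → R) : Trie → R
  | nil => 0
  | node c a₁ a₂ a₃ a₄ =>
    c + f .x * a₁.eval f + f .y * a₂.eval f + f .z * a₃.eval f + f .t * a₄.eval f

end Trie

/-- The value of an iterated Jordan product. -/
def Jordan.eval {R : Type*} [Ring R] (f : Letter → R) : Jordan → R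
  | .of i => f i
  | .mul a b => a.eval f * b.eval f + b.eval f * a.eval f

section eval

variable {R : Type*} [Ring R] (f : Letter → R)

theorem Trie.eval_add (p q : Trie) : (p.add q).eval f = p.eval f + q.eval f := by
  induction p generalizing q with
  | nil => cases q <;> simp [Trie.add, Trie.eval]
  | node c a₁ a₂ a₃ a₄ h₁ h₂ h₃ h₄ =>
    cases q with
    | nil => simp [Trie.add, Trie.eval]
    | node d b₁ b₂ b₃ b₄ =>
      simp only [Trie.add, Trie.eval, h₁, h₂, h₃, h₄, Int.cast_add, mul_add]
      abel

theorem Trie.eval_eq_zero {p : Trie} (h : p.isZero = true) : p.eval f = 0 := by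
  induction p with
  | nil => rfl
  | node c a₁ a₂ a₃ a₄ h₁ h₂ h₃ h₄ =>
    simp only [Trie.isZero, Bool.and_eq_true, decide_eq_true_eq] at h
    obtain ⟨⟨⟨⟨rfl, e₁⟩, e₂⟩, e₃⟩, e₄⟩ := h
    simp [Trie.eval, h₁ e₁, h₂ e₂, h₃ e₃, h₄ e₄]

theorem Trie.eval_letter (i : Letter) (p : Trie) : (p.letter i).eval f = f i * p.eval f := by
  cases i <;> simp [Trie.letter, Trie.eval]

theorem Trie.eval_jordan (a : Jordan) (p : Trie) :
    (p.jordan a).eval f = a.eval f * p.eval f := by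
  induction a generalizing p with
  | of i => exact Trie.eval_letter f i p
  | mul a b ha hb =>
    simp only [Trie.jordan, Jordan.eval, Trie.eval_add, ha, hb, add_mul, mul_assoc]

theorem Trie.eval_word (l : List Letter) (p : Trie) :
    (p.word l).eval f = (l.map f).prod * p.eval f := by
  induction l with
  | nil => simp [Trie.word]
  | cons i l h => simp [Trie.word, Trie.eval_letter, h, mul_assoc]

theorem Trie.eval_sym (a b c : Jordan) (p : Trie) :
    (p.sym a b c).eval f = (a.eval f * b.eval f * c.eval f + a.eval f * c.eval f * b.eval f
      + b.eval f * c.eval f * a.eval f + b.eval f * a.eval f * c.eval f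
      + c.eval f * a.eval f * b.eval f + c.eval f * b.eval f * a.eval f) * p.eval f := by
  simp only [Trie.sym, Trie.eval_add, Trie.eval_jordan]
  noncomm_ring

end eval

/-- A two-sided multiple of the symmetrized product of three Jordan elements. -/
abbrev Relator : Type := ℤ × List Letter × Jordan × Jordan × Jordan × List Letter

/-- A relator as a polynomial. -/
def Relator.trie : Relator → Trie
  | (c, l, a, b, d, r) => (((Trie.node c .nil .nil .nil .nil).word r).sym a b d).word l

/-- The sum of a list of relators. -/
def relatorSum (l : List Relator) : Trie :=
  l.foldr (fun e p => e.trie.add p) .nil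

/-- The sum of a list of lists of relators. -/
def relatorSums (l : List (List Relator)) : Trie :=
  l.foldr (fun e p => (relatorSum e).add p) .nil

/-- Substitution of letters in a Jordan element. -/
def Jordan.map (σ : Letter → Letter) : Jordan → Jordan
  | .of i => .of (σ i)
  | .mul a b => .mul (a.map σ) (b.map σ)

/-- Substitution of letters in a relator, with a sign. -/
def Relator.map (s : ℤ) (σ : Letter → Letter) : Relator → Relator
  | (c, l, a, b, d, r) => (s * c, l.map σ, a.map σ, b.map σ, d.map σ, r.map σ)

/-- The mirror image of a relator. -/
def Relator.reverse : Relator → Relator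
  | (c, l, a, b, d, r) => (c, r.reverse, a, b, d, l.reverse)

/-- Exchange of the letters `x` and `y`. -/
def swapXY : Letter → Letter
  | .x => .y | .y => .x | .z => .z | .t => .t

/-- Exchange of the letters `z` and `t`. -/
def swapZT : Letter → Letter
  | .x => .x | .y => .y | .z => .t | .t => .z

/-- The orbit of a relator under the symmetries of `[[x², y²], z² ∘ t²]`. -/
def Relator.orbit (e : Relator) : List Relator :=
  [e, e.map (-1) swapXY, e.map 1 swapZT, e.map (-1) (swapXY ∘ swapZT),
    e.reverse, (e.map (-1) swapXY).reverse, (e.map 1 swapZT).reverse,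
    (e.map (-1) (swapXY ∘ swapZT)).reverse]

open Letter in
/-- Relators whose orbits add up to a multiple of `[[x², y²], z² ∘ t²]`. -/
def relators : List (List Relator) :=
  [[(4,[],y,x,x,[y,z,t,t,z]), (-12,[],y,x,x,[z,y,t,z,t]), (22,[],y,x,x,[z,z,t,t,y]),
    (12,[],y,x,x,[t,y,t,z,z]), (-68,[],y,y,x,[x,t,t,z,z]), (-76,[],y,y,x,[z,z,x,t,t]),
    (8,[],y,y,x,[z,t,x,z,t]), (16,[],y,y,x,[t,x,z,z,t]), (16,[],y,y,x,[t,z,x,z,t]),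
    (18,[],y,y,x,[t,z,t,z,x]), (-18,[],z,x,x,[y,y,z,t,t]), (-8,[],z,x,x,[y,t,y,z,t]),
    (-8,[],z,x,x,[y,t,z,t,y]), (8,[],z,y,x,[x,t,t,z,y]), (16,[],z,y,x,[t,y,z,x,t]),
    (10,[],z,y,y,[x,x,t,t,z]), (20,[],z,y,y,[z,t,x,x,t]), (8,[],z,y,y,[t,x,x,t,z])],
   [(-8,[],z,y,y,[t,x,z,x,t]), (-4,[],z,y,y,[t,x,t,z,x]), (8,[],z,y,y,[t,z,x,t,x]),
    (24,[],z,z,x,[t,y,x,y,t]), (8,[],z,z,x,[t,y,y,t,x]), (-24,[],z,z,x,[t,y,t,y,x]),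
    (20,[],z,z,y,[y,x,x,t,t]), (24,[],t,x,x,[y,z,z,y,t]), (4,[],t,x,x,[z,z,y,y,t]),
    (-20,[],t,x,x,[t,z,y,z,y]), (-8,[],t,y,x,[z,z,y,x,t]), (-8,[],t,y,x,[z,z,y,t,x]),
    (-8,[],t,y,x,[z,t,x,y,z]), (-8,[],t,y,x,[z,t,y,z,x]), (34,[],t,y,y,[x,x,z,t,z]),
    (24,[],t,y,y,[x,t,z,z,x]), (8,[],t,y,y,[z,x,z,x,t]), (-16,[],t,z,x,[y,x,t,y,z])],
   [(16,[],t,z,x,[t,y,z,x,y]), (-16,[],t,z,y,[x,x,z,y,t]), (16,[],t,z,y,[x,y,t,z,x]),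
    (16,[],t,z,y,[x,t,z,y,x]), (-16,[],t,z,y,[y,x,t,z,x]), (-30,[],t,z,z,[x,x,y,t,y]),
    (16,[],t,z,z,[x,y,t,y,x]), (2,[],t,z,z,[y,x,x,y,t]), (-12,[],t,z,z,[y,t,x,x,y]),
    (4,[],t,z,z,[t,x,x,y,y]), (16,[],t,z,z,[t,y,x,y,x]), (-16,[],t,t,x,[x,z,z,y,y]),
    (32,[],t,t,x,[y,y,z,z,x]), (32,[],t,t,y,[x,x,y,z,z]), (24,[],t,t,y,[x,x,z,y,z]),
    (8,[],t,t,y,[z,z,y,x,x]), (-22,[],t,t,z,[x,x,z,y,y]), (-12,[],t,t,z,[x,y,x,z,y])],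
   [(-8,[],t,t,z,[x,y,z,x,y]), (-12,[],t,t,z,[y,x,x,z,y]), (-2,[],t,t,z,[y,x,y,x,z]),
    (12,[],t,t,z,[y,z,x,y,x]), (8,[x,x],t,z,z,[y,y,t]), (-24,[x,y],z,y,x,[t,t,z]),
    (50,[x,y],z,z,y,[t,t,x]), (4,[x,y],t,z,z,[x,y,t]), (-4,[x,y],t,z,z,[y,x,t]),
    (-8,[x,y],t,z,z,[y,t,x]), (-4,[x,z],t,y,y,[z,t,x]), (8,[x,z],t,t,y,[x,z,y]),
    (-8,[x,z],t,t,y,[y,z,x]), (-4,[x,t],z,z,x,[y,y,t]), (32,[x,t],t,y,x,[z,z,y]),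
    (-18,[x,t],t,z,z,[x,y,y]), (-18,[x,t],t,z,z,[y,x,y]), (-16,[x],y,y,x,[z,t,z,t])],
   [(-18,[x],z,y,y,[t,z,t,x]), (-8,[x],t,y,y,[x,z,t,z]), (-12,[x],t,y,y,[x,t,z,z]),
    (8,[x],t,y,y,[z,x,t,z]), (-16,[x],t,z,x,[z,t,y,y]), (-16,[x],t,z,y,[x,z,t,y]),
    (16,[x],t,z,y,[y,x,z,t]), (-64,[x],t,z,y,[z,x,t,y]), (24,[x],t,z,y,[t,y,z,x]),
    (8,[x],t,z,z,[y,y,x,t]), (18,[x],t,z,z,[y,t,y,x]), (-16,[x],t,t,x,[y,z,z,y]),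
    (-20,[x],t,t,x,[z,z,y,y]), (-16,[x],t,t,y,[z,x,z,y]), (8,[y,x],t,t,y,[x,z,z]),
    (-12,[y,x],t,t,y,[z,z,x]), (-20,[y,x],t,t,z,[y,z,x]), (-12,[y,y],z,x,x,[t,z,t])],
   [(44,[y,y],z,z,x,[x,t,t]), (-4,[y,z],y,x,x,[t,z,t]), (12,[y,z],y,x,x,[t,t,z]),
    (32,[y,z],z,x,x,[y,t,t]), (-16,[y,z],t,x,x,[t,y,z]), (4,[y,z],t,x,x,[t,z,y]),
    (-8,[y,z],t,t,x,[x,y,z]), (8,[y,z],t,t,x,[z,y,x]), (-4,[y,t],z,z,y,[x,t,x]),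
    (-12,[y,t],z,z,y,[t,x,x]), (-24,[y],z,x,x,[z,t,y,t]), (40,[y],z,x,x,[z,t,t,y]),
    (16,[y],z,x,x,[t,t,y,z]), (10,[y],z,x,x,[t,t,z,y]), (24,[y],z,y,x,[x,z,t,t]),
    (-16,[y],z,y,x,[t,x,z,t]), (32,[y],z,y,x,[t,t,x,z]), (-32,[y],z,z,x,[x,y,t,t])],
   [(-24,[y],t,x,x,[t,y,z,z]), (16,[y],t,z,x,[x,t,y,z]), (-14,[y],t,z,z,[x,x,t,y]),
    (8,[y],t,z,z,[y,x,t,x]), (20,[y],t,t,x,[y,z,z,x]), (-8,[y],t,t,x,[z,z,x,y]),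
    (8,[y],t,t,z,[x,z,y,x]), (16,[y],t,t,z,[y,z,x,x]), (-8,[z,x],z,y,y,[x,t,t]),
    (-8,[z,x],t,y,y,[t,x,z]), (-56,[z,x],t,z,x,[y,y,t]), (8,[z,x],t,t,y,[y,x,z]),
    (8,[z,x],t,t,y,[z,x,y]), (8,[z,x],t,t,y,[z,y,x]), (8,[z,y],t,x,x,[z,y,t]),
    (8,[z,y],t,x,x,[t,z,y]), (32,[z,y],t,y,x,[z,x,t]), (8,[z,y],t,t,y,[x,x,z])],
   [(12,[z,z],y,y,x,[x,t,t]), (24,[z,z],y,y,x,[t,x,t]), (44,[z,z],t,y,y,[t,x,x]),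
    (-12,[z,z],t,t,y,[x,x,y]), (-12,[z,z],t,t,y,[x,y,x]), (8,[z,t],y,x,x,[z,y,t]),
    (8,[z,t],y,x,x,[t,y,z]), (-8,[z,t],y,y,x,[z,t,x]), (-8,[z,t],y,y,x,[t,z,x]),
    (32,[z,t],z,y,x,[x,t,y]), (-32,[z,t],t,z,x,[y,y,x]), (2,[z],y,x,x,[y,z,t,t]),
    (-8,[z],y,x,x,[t,z,y,t]), (-4,[z],y,x,x,[t,t,z,y]), (-24,[z],y,y,x,[z,x,t,t]),
    (12,[z],z,x,x,[y,t,y,t]), (-48,[z],z,y,x,[x,y,t,t]), (8,[z],t,x,x,[y,y,t,z])],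
   [(-8,[z],t,x,x,[y,z,t,y]), (12,[z],t,y,y,[x,x,z,t]), (-8,[z],t,y,y,[z,t,x,x]),
    (8,[z],t,y,y,[t,x,z,x]), (8,[z],t,t,x,[y,z,y,x]), (-16,[z],t,t,x,[z,x,y,y]),
    (-32,[z],t,t,z,[y,x,x,y]), (-48,[t,x],t,z,y,[x,y,z]), (-2,[t,y],y,x,x,[z,z,t]),
    (8,[t,y],z,z,x,[y,t,x]), (8,[t,y],z,z,y,[t,x,x]), (16,[t,z],z,y,x,[t,x,y]),
    (-16,[t,z],t,y,x,[z,y,x]), (8,[t,z],t,y,y,[x,x,z]), (-8,[t,t],z,y,y,[x,x,z]),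
    (24,[t],y,x,x,[t,z,z,y]), (-2,[t],y,y,x,[x,z,t,z]), (-20,[t],z,x,x,[y,t,y,z])],
   [(-16,[t],z,y,x,[t,x,z,y]), (8,[t],z,y,y,[x,z,t,x]), (-8,[t],z,y,y,[t,x,z,x]),
    (-16,[t],z,z,x,[t,y,x,y]), (16,[t],z,z,y,[x,t,y,x]), (16,[t],t,x,x,[z,y,y,z]),
    (8,[],t⋄z,x,x,[y,y,z,t]), (-12,[],t⋄t,y,x,[z,z,y,x]), (-10,[],t⋄t,y,y,[x,x,z,z]),
    (-8,[],y,y,z⋄x,[t,t,x,z]), (4,[],z,z,y⋄x,[t,y,x,t]), (-14,[],z,z,y⋄y,[t,x,x,t]),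
    (-8,[],z,z,t⋄x,[y,t,x,y]), (16,[],t,z⋄y,x,[z,x,t,y]), (-20,[],t,t,y⋄x,[y,x,z,z]),
    (4,[],t,t,z⋄z,[x,y,x,y]), (-12,[x,x],z,z,y⋄y,[t,t]), (8,[x,z],y,y,t⋄x,[z,t])],
   [(-2,[x,t],z,z,y⋄y,[t,x]), (-24,[x],t⋄t,y,x,[z,z,y]), (16,[x],t,t,z⋄y,[x,z,y]),
    (-2,[y,x],t,t,z⋄z,[x,y]), (8,[y,y],t⋄t,z,x,[x,z]), (8,[y,t],z,z,x⋄x,[y,t]),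
    (-4,[y,t],t,z,x⋄x,[z,y]), (23,[y],t⋄t,x,x,[z,z,y]), (-5,[y],t⋄t,z,z,[y,x,x]),
    (16,[y],z,z,x⋄x,[t,y,t]), (-16,[y],t,z⋄z,x,[t,y,x]), (8,[y],t,z⋄z,y,[t,x,x]),
    (-9,[y],t,t,z⋄z,[x,y,x]), (-4,[z,x],t⋄z,y,y,[x,t]), (2,[z,y],t⋄t,x,x,[y,z]),
    (-8,[z],t⋄t,y,y,[x,x,z]), (-20,[z],t,z,x⋄x,[y,y,t]), (4,[t],z⋄z,x,x,[y,t,y])],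
   [(24,[t],y,y,t⋄x,[z,x,z]), (8,[t],z,y,x⋄x,[t,z,y]), (-24,[t],t,y⋄y,x,[x,z,z]),
    (-8,[],z⋄(t⋄y),x,x,[z,t,y]), (-4,[],t⋄(z⋄z),y,x,[t,y,x]), (-14,[],t⋄t,z⋄z,y,[x,y,x]),
    (-20,[],z,z,y⋄(x⋄x),[y,t,t]), (8,[],z,z,t⋄(x⋄x),[y,y,t]), (6,[],t,z⋄z,x⋄x,[t,y,y]),
    (-16,[x],t⋄t,z⋄z,y,[x,y]), (5,[x],t⋄t,z,y⋄y,[z,x]), (4,[y],t,y,(z⋄z)⋄x,[t,x]),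
    (4,[t],t⋄z,y⋄y,x,[x,z]), (-3,[],(t⋄t)⋄(z⋄z),x,x,[y,y]), (-8,[],z⋄z,y,t⋄(x⋄x),[y,t]),
    (4,[],t,(z⋄z)⋄(y⋄y),x,[x,t]), (-3,[],(t⋄t)⋄(z⋄z),y,x⋄x,[y]), (4,[],t,z,(t⋄(y⋄y))⋄(x⋄x),[z])]  ]

/-- The polynomial `-192 [[x², y²], z² ∘ t²]`. -/
def target : Trie :=
  let w (c : ℤ) (a b d e : Letter) : Trie :=
    (Trie.node c .nil .nil .nil .nil).word [a, a, b, b, d, d, e, e]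
  (((w (-192) .x .y .z .t).add (w 192 .y .x .z .t)).add
    ((w (-192) .x .y .t .z).add (w 192 .y .x .t .z))).add
  (((w 192 .z .t .x .y).add (w (-192) .z .t .y .x)).add
    ((w 192 .t .z .x .y).add (w (-192) .t .z .y .x)))

/-- The certificate: the listed relators, with their orbits, add up to `192 [[x², y²], z² ∘ t²]`,
checked by evaluation in the kernel. Passing to orbits is legitimate since symmetrized products and
Jordan products are stable under relabelling and reversal; the target changes sign under `x ↔ y`
only, which explains the signs in `Relator.orbit`. -/
theorem isZero_relatorSums :
    (target.add (relatorSums (relators.map (fun l => l.flatMap Relator.orbit)))).isZero = true := by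
  decide +kernel

end FourLetters

/-! ### The certificate as an identity in an arbitrary ring -/

namespace FourLetters

theorem eval_jordan_mem {R : Type*} [Ring R] {J : Set R}
    (hJ : ∀ a ∈ J, ∀ b ∈ J, a * b + b * a ∈ J) {f : Letter → R} (hf : ∀ i, f i ∈ J) (a : Jordan) :
    a.eval f ∈ J := by
  induction a with
  | of i => exact hf i
  | mul a b ha hb => exact hJ _ ha _ hb

/-- In a set of ring elements that is closed under the Jordan product and on which the
symmetrized product of three elements vanishes, `[[x², y²], z² ∘ t²] = 0` up to torsion. -/
theorem commutator_squares {R : Type*} [Ring R] {J : Set R}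
    (hJ : ∀ a ∈ J, ∀ b ∈ J, a * b + b * a ∈ J)
    (hs : ∀ a ∈ J, ∀ b ∈ J, ∀ c ∈ J,
      a * b * c + a * c * b + b * c * a + b * a * c + c * a * b + c * b * a = 0)
    {x y z t : R} (hx : x ∈ J) (hy : y ∈ J) (hz : z ∈ J) (ht : t ∈ J) :
    (192 : ℤ) • ((x * x * (y * y) - y * y * (x * x)) * (z * z * (t * t) + t * t * (z * z))
      - (z * z * (t * t) + t * t * (z * z)) * (x * x * (y * y) - y * y * (x * x))) = 0 := by
  let f : Letter → R := fun | .x => x | .y => y | .z => z | .t => t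
  have hf : ∀ i, f i ∈ J := by rintro (_ | _ | _ | _) <;> assumption
  have hrel (e : Relator) : e.trie.eval f = 0 := by
    obtain ⟨c, l, a, b, d, r⟩ := e
    rw [Relator.trie, Trie.eval_word, Trie.eval_sym,
      hs _ (eval_jordan_mem hJ hf a) _ (eval_jordan_mem hJ hf b) _ (eval_jordan_mem hJ hf d),
      zero_mul, mul_zero]
  have hsum (l : List Relator) : (relatorSum l).eval f = 0 := by
    induction l with
    | nil => rfl
    | cons e l ih =>
      change (e.trie.add (relatorSum l)).eval f = 0
      rw [Trie.eval_add, hrel, ih, add_zero]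
  have hsums (l : List (List Relator)) : (relatorSums l).eval f = 0 := by
    induction l with
    | nil => rfl
    | cons e l ih =>
      change ((relatorSum e).add (relatorSums l)).eval f = 0
      rw [Trie.eval_add, hsum, ih, add_zero]
  have h := Trie.eval_eq_zero f isZero_relatorSums
  rw [Trie.eval_add, hsums, add_zero, target] at h
  simp only [Trie.eval_add, Trie.eval_word, List.map_cons, List.map_nil, List.prod_cons,
    List.prod_nil, Trie.eval, mul_zero, add_zero, mul_one, f] at h
  rw [← neg_eq_zero, ← h]
  simp only [zsmul_eq_mul, Int.cast_neg, Int.cast_ofNat]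
  noncomm_ring

end FourLetters

/-! ### Eliminating letters from words -/

/-- All products of `m` elements of `S` vanish, for some `m`. -/
def WordsVanish {R : Type*} [Ring R] (S : Set R) : Prop :=
  ∃ m : ℕ, ∀ w : List R, (∀ s ∈ w, s ∈ S) → w.length = m → w.prod = 0

theorem WordsVanish.mono {R : Type*} [Ring R] {S T : Set R} (h : WordsVanish T) (hST : S ⊆ T) :
    WordsVanish S :=
  h.imp fun _ hm w hw => hm w fun s hs => hST (hw s hs)

/-- The right ideal generated by the products of `l` elements of `S`. -/
def wordIdeal {R : Type*} [Ring R] (S : Set R) (l : ℕ) : AddSubgroup R :=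
  AddSubgroup.closure {r | ∃ w : List R, (∀ s ∈ w, s ∈ S) ∧ w.length = l ∧ ∃ q, r = w.prod * q}

section elimination

variable {R : Type*} [Ring R] {S : Set R}

theorem mem_wordIdeal_zero (r : R) : r ∈ wordIdeal S 0 :=
  AddSubgroup.subset_closure ⟨[], by simp, rfl, r, by simp⟩

theorem mul_mem_wordIdeal {s r : R} {l : ℕ} (hs : s ∈ S) (hr : r ∈ wordIdeal S l) :
    s * r ∈ wordIdeal S (l + 1) := by
  induction hr using AddSubgroup.closure_induction with
  | mem r hr =>
    obtain ⟨w, hw, hl, q, rfl⟩ := hr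
    exact AddSubgroup.subset_closure ⟨s :: w, by simpa using ⟨hs, hw⟩, by simp [hl], q,
      by simp [mul_assoc]⟩
  | zero => simp
  | add a b _ _ ha hb => rw [mul_add]; exact add_mem ha hb
  | neg a _ ha => rw [mul_neg]; exact neg_mem ha

theorem wordIdeal_eq_zero {m : ℕ}
    (h : ∀ w : List R, (∀ s ∈ w, s ∈ S) → w.length = m → w.prod = 0) {r : R}
    (hr : r ∈ wordIdeal S m) : r = 0 := by
  induction hr using AddSubgroup.closure_induction with
  | mem r hr =>
    obtain ⟨w, hw, hl, q, rfl⟩ := hr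
    rw [h w hw hl, zero_mul]
  | zero => rfl
  | add a b _ _ ha hb => rw [ha, hb, add_zero]
  | neg a _ ha => rw [ha, neg_zero]

/-- The letters that replace those of `S` when `a` is eliminated. -/
def eliminationSet (a : R) (S : Set R) : Set R :=
  {r | ∃ b ∈ S, r = b ∨ r = b * a + a * b ∨ r = b * (a * a) + a * a * b}

/-- Pushing `a` to the right past a letter replaces that letter by another one of the elimination
set and leaves powers of `a` in front of a shorter word, where induction on `l` applies. The process
closes after `b ∘ a` and `b ∘ a²` because `a ^ 3 = 0`. -/
theorem left_mul_mem_wordIdeal {a : R} (ha : a * a * a = 0) {l : ℕ} {r : R}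
    (hr : r ∈ wordIdeal (eliminationSet a S) l) : a * r ∈ wordIdeal (eliminationSet a S) l := by
  induction l generalizing r with
  | zero => exact mem_wordIdeal_zero _
  | succ l ih =>
    induction hr using AddSubgroup.closure_induction with
    | zero => simp
    | add a b _ _ ha hb => rw [mul_add]; exact add_mem ha hb
    | neg a _ ha => rw [mul_neg]; exact neg_mem ha
    | mem r hr =>
      obtain ⟨w, hw, hl, q, rfl⟩ := hr
      cases w with
      | nil => simp at hl
      | cons s w =>
        simp only [List.mem_cons, forall_eq_or_imp] at hw
        have hr : w.prod * q ∈ wordIdeal (eliminationSet a S) l :=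
          AddSubgroup.subset_closure ⟨w, hw.2, by simpa using hl, q, rfl⟩
        generalize hp : w.prod * q = p at hr
        rw [List.prod_cons, mul_assoc, hp]
        have h1 := ih hr
        have h2 := ih h1
        obtain ⟨b, hb, rfl | rfl | rfl⟩ := hw.1
        · have e : a * (s * p) = (s * a + a * s) * p - s * (a * p) := by noncomm_ring
          rw [e]
          exact sub_mem (mul_mem_wordIdeal ⟨s, hb, .inr (.inl rfl)⟩ hr)
            (mul_mem_wordIdeal ⟨s, hb, .inl rfl⟩ h1)
        · have e : a * ((b * a + a * b) * p) = (b * (a * a) + a * a * b) * p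
              - (b * (a * (a * p)) + b * (a * (a * p))) + (b * a + a * b) * (a * p) := by
            noncomm_ring
          rw [e]
          have h3 := mul_mem_wordIdeal (S := eliminationSet a S) ⟨b, hb, .inl rfl⟩ h2
          exact add_mem (sub_mem (mul_mem_wordIdeal ⟨b, hb, .inr (.inr rfl)⟩ hr) (add_mem h3 h3))
            (mul_mem_wordIdeal ⟨b, hb, .inr (.inl rfl)⟩ h1)
        · have e : a * ((b * (a * a) + a * a * b) * p) = (b * a + a * b) * (a * (a * p))
              + a * a * a * b * p - b * (a * a * a) * p := by
            noncomm_ring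
          rw [e, ha, zero_mul, zero_mul, mul_zero, zero_mul, add_zero, sub_zero]
          exact mul_mem_wordIdeal ⟨b, hb, .inr (.inl rfl)⟩ h2

/-- Elimination of a letter with vanishing cube. -/
theorem WordsVanish.insert_of_elimination {a : R} (ha : a * a * a = 0)
    (h : WordsVanish (eliminationSet a S)) : WordsVanish (insert a S) := by
  obtain ⟨m, hm⟩ := h
  -- Three consecutive letters either are `a a a`, with product zero, or include a letter of `S`,
  -- which contributes one letter of the elimination set; the copies of `a` around it are absorbed.
  have key : ∀ l, ∀ w : List R, (∀ s ∈ w, s ∈ insert a S) → w.length = 3 * l →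
      w.prod ∈ wordIdeal (eliminationSet a S) l := by
    intro l
    induction l with
    | zero => exact fun w _ _ => mem_wordIdeal_zero _
    | succ l ih =>
      intro w hw hl
      obtain ⟨s₁, s₂, s₃, w, rfl⟩ : ∃ s₁ s₂ s₃ w', w = s₁ :: s₂ :: s₃ :: w' := by
        match w, hl with
        | s₁ :: s₂ :: s₃ :: w', _ => exact ⟨s₁, s₂, s₃, w', rfl⟩
        | [], hl => simp at hl
        | [_], hl => simp at hl; omega
        | [_, _], hl => simp at hl; omega
      simp only [List.mem_cons, forall_eq_or_imp] at hw
      obtain ⟨h1, h2, h3, hw⟩ := hw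
      have hw' := ih w hw (by simp at hl; omega)
      have weaken : ∀ l r, r ∈ wordIdeal (eliminationSet a S) (l + 1) →
          r ∈ wordIdeal (eliminationSet a S) l := by
        intro l r hr
        induction hr using AddSubgroup.closure_induction with
        | zero => exact zero_mem _
        | add a b _ _ ha hb => exact add_mem ha hb
        | neg a _ ha => exact neg_mem ha
        | mem r hr =>
          obtain ⟨w, hw, hl, q, rfl⟩ := hr
          refine AddSubgroup.subset_closure ⟨w.take l, fun s hs => hw s (List.mem_of_mem_take hs),
            by simp [hl], (w.drop l).prod * q, ?_⟩
          rw [← mul_assoc, ← List.prod_append, List.take_append_drop]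
      have step : ∀ s ∈ insert a S, ∀ k r, r ∈ wordIdeal (eliminationSet a S) k →
          s * r ∈ wordIdeal (eliminationSet a S) k := by
        rintro s (rfl | hs) k r hr
        · exact left_mul_mem_wordIdeal ha hr
        · exact weaken _ _ (mul_mem_wordIdeal ⟨s, hs, .inl rfl⟩ hr)
      have gain : ∀ s ∈ S, ∀ r, r ∈ wordIdeal (eliminationSet a S) l →
          s * r ∈ wordIdeal (eliminationSet a S) (l + 1) :=
        fun s hs r hr => mul_mem_wordIdeal ⟨s, hs, .inl rfl⟩ hr
      simp only [List.prod_cons]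
      rcases h3 with rfl | h3'
      · rcases h2 with rfl | h2'
        · rcases h1 with rfl | h1'
          · rw [← mul_assoc, ← mul_assoc, ha, zero_mul]
            exact zero_mem _
          · exact gain _ h1' _ (step _ (.inl rfl) _ _ (step _ (.inl rfl) _ _ hw'))
        · exact step _ h1 _ _ (gain _ h2' _ (step _ (.inl rfl) _ _ hw'))
      · exact step _ h1 _ _ (step _ h2 _ _ (gain _ h3' _ hw'))
  exact ⟨3 * m, fun w hw hl => wordIdeal_eq_zero hm (key m w hw hl)⟩

end elimination

/-! ### Commutative algebras with vanishing cubes -/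

section CubeZero

set_option linter.unusedSectionVars false

variable {K : Type u} {A : Type v} [Field K] [NonUnitalNonAssocCommRing A] [Module K A]
  [IsScalarTower K A A] [SMulCommClass K A A]

theorem smul_eq_zero_of_two_three (h2 : (2 : K) ≠ 0) (h3 : (3 : K) ≠ 0) {M : Type*}
    [AddCommGroup M] [Module K M] (i j : ℕ) {x : M} (h : ((2 : ℤ) ^ i * 3 ^ j) • x = 0) :
    x = 0 := by
  have h' : ((2 : K) ^ i * 3 ^ j) • x = 0 := by
    rw [← h, ← Int.cast_smul_eq_zsmul K]
    push_cast
    rfl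
  exact (smul_eq_zero.1 h').resolve_left (mul_ne_zero (pow_ne_zero _ h2) (pow_ne_zero _ h3))

theorem eq_zero_of_two_smul (h2 : (2 : K) ≠ 0) {M : Type*} [AddCommGroup M] [Module K M] {x : M}
    (h : (2 : K) • x = 0) : x = 0 :=
  (smul_eq_zero.1 h).resolve_left h2

variable (K) in
/-- The linear operators of multiplication. -/
abbrev mulOp (x : A) : Module.End K A := LinearMap.mulLeft K x

theorem mulOp_add (x y : A) : mulOp K (x + y) = mulOp K x + mulOp K y :=
  LinearMap.ext fun v => add_mul x y v

theorem mulOp_sub (x y : A) : mulOp K (x - y) = mulOp K x - mulOp K y :=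
  LinearMap.ext fun v => sub_mul x y v

theorem mulOp_smul (c : K) (x : A) : mulOp K (c • x) = c • mulOp K x :=
  LinearMap.ext fun v => smul_mul_assoc c x v

theorem mulOp_zero : mulOp K (0 : A) = 0 :=
  LinearMap.ext fun v => zero_mul v

theorem mulOp_neg (x : A) : mulOp K (-x) = -mulOp K x :=
  LinearMap.ext fun v => neg_mul x v

theorem cyclic_of_cube_zero (h2 : (2 : K) ≠ 0) (h : ∀ x : A, x * x * x = 0) (x y z : A) :
    x * y * z + y * z * x + z * x * y = 0 := by
  have h1 : (2 : K) • (x * y * z + y * z * x + z * x * y) = 0 := by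
    have e : x * y * z + y * z * x + z * x * y + (x * y * z + y * z * x + z * x * y)
        = (x + y + z) * (x + y + z) * (x + y + z) - (x + y) * (x + y) * (x + y)
          - (y + z) * (y + z) * (y + z) - (x + z) * (x + z) * (x + z)
          + x * x * x + y * y * y + z * z * z := by
      simp only [add_mul, mul_add, mul_comm y x, mul_comm z x, mul_comm z y]
      abel
    rw [two_smul, e]
    simp only [h]
    abel
  exact (smul_eq_zero.1 h1).resolve_left h2

/-- The cyclic identity read as an operator acting on its third argument. Up to sign, the
multiplication operators are thus closed under the Jordan product. -/
theorem mulOp_mul (hc : ∀ x y z : A, x * y * z + y * z * x + z * x * y = 0) (x y : A) :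
    mulOp K (x * y) = -(mulOp K x * mulOp K y + mulOp K y * mulOp K x) := by
  ext v
  have h := hc x y v
  simp only [LinearMap.mulLeft_apply, LinearMap.neg_apply, LinearMap.add_apply,
    Module.End.mul_apply]
  rw [eq_neg_iff_add_eq_zero, ← h, mul_comm x (y * v), mul_comm y (x * v), mul_comm v x]
  abel

/-- Take the multiplication operator of the cyclic identity and expand it twice with `mulOp_mul`:
each of the six orderings appears exactly twice. -/
theorem mulOp_sym (h2 : (2 : K) ≠ 0)
    (hc : ∀ x y z : A, x * y * z + y * z * x + z * x * y = 0) (x y z : A) :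
    mulOp K x * mulOp K y * mulOp K z + mulOp K x * mulOp K z * mulOp K y
      + mulOp K y * mulOp K z * mulOp K x + mulOp K y * mulOp K x * mulOp K z
      + mulOp K z * mulOp K x * mulOp K y + mulOp K z * mulOp K y * mulOp K x = 0 := by
  refine eq_zero_of_two_smul h2 ?_
  have e := congrArg (mulOp K) (hc x y z)
  rw [mulOp_add, mulOp_add, mulOp_zero, mulOp_mul hc (x * y), mulOp_mul hc (y * z),
    mulOp_mul hc (z * x), mulOp_mul hc x, mulOp_mul hc y, mulOp_mul hc z] at e
  rw [two_smul, ← e]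
  noncomm_ring

theorem mulOp_cube (h2 : (2 : K) ≠ 0) (h3 : (3 : K) ≠ 0)
    (hc : ∀ x y z : A, x * y * z + y * z * x + z * x * y = 0) (x : A) :
    mulOp K x * mulOp K x * mulOp K x = 0 := by
  refine smul_eq_zero_of_two_three h2 h3 1 1 ?_
  rw [← mulOp_sym h2 hc x x x]
  norm_num
  noncomm_ring

variable (K A) in
/-- The elements that annihilate the algebra. -/
def annihilator : Submodule K A := LinearMap.ker (LinearMap.mul K A)

theorem mem_annihilator {x : A} : x ∈ annihilator K A ↔ mulOp K x = 0 := Iff.rfl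

/-- The multiplication operators of `a (b (c d)) - b (a (c d))` vanish for squares. -/
theorem squares_mem_annihilator (h2 : (2 : K) ≠ 0) (h3 : (3 : K) ≠ 0)
    (hc : ∀ x y z : A, x * y * z + y * z * x + z * x * y = 0) (x y z t : A) :
    x * x * (y * y * (z * z * (t * t))) - y * y * (x * x * (z * z * (t * t)))
      ∈ annihilator K A := by
  rw [mem_annihilator]
  have h := FourLetters.commutator_squares (J := Set.range (mulOp K : A → Module.End K A))
    (by
      rintro _ ⟨a, rfl⟩ _ ⟨b, rfl⟩
      exact ⟨-(a * b), by rw [mulOp_neg, mulOp_mul hc, neg_neg]⟩)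
    (by
      rintro _ ⟨a, rfl⟩ _ ⟨b, rfl⟩ _ ⟨c, rfl⟩
      exact mulOp_sym h2 hc a b c) ⟨x, rfl⟩ ⟨y, rfl⟩ ⟨z, rfl⟩ ⟨t, rfl⟩
  -- Since `L_{x²} = -2 L_x²`, the operator in question is `-16` times the double commutator, and
  -- `12 * 16 = 192`.
  refine smul_eq_zero_of_two_three h2 h3 2 1 ?_
  rw [mulOp_sub]
  simp only [mulOp_mul hc]
  rw [← neg_eq_zero, ← h]
  norm_num
  noncomm_ring

/-! ### The derived series and the annihilator -/

variable (K) in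
/-- The derived series: the terms are spanned by the products of elements of the preceding term. -/
def derivedSubspace (A : Type v) [NonUnitalNonAssocCommRing A] [Module K A] : ℕ → Submodule K A
  | 0 => ⊤
  | n + 1 => Submodule.span K {r | ∃ x ∈ derivedSubspace A n, ∃ y ∈ derivedSubspace A n, r = x * y}

theorem mul_mem_derivedSubspace {n : ℕ} {x y : A} (hx : x ∈ derivedSubspace K A n)
    (hy : y ∈ derivedSubspace K A n) : x * y ∈ derivedSubspace K A (n + 1) :=
  Submodule.subset_span ⟨x, hx, y, hy, rfl⟩

theorem derivedSubspace_succ_le (n : ℕ) : derivedSubspace K A (n + 1) ≤ derivedSubspace K A n := by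
  induction n with
  | zero => exact le_top
  | succ n ih =>
    refine Submodule.span_mono ?_
    rintro _ ⟨x, hx, y, hy, rfl⟩
    exact ⟨x, ih hx, y, ih hy, rfl⟩

theorem derivedSubspace_one_le (h2 : (2 : K) ≠ 0) :
    derivedSubspace K A 1 ≤ Submodule.span K (Set.range fun x : A => x * x) := by
  refine Submodule.span_le.2 ?_
  rintro _ ⟨x, -, y, -, rfl⟩
  have e : x * y = (2⁻¹ : K) • ((x + y) * (x + y) - x * x - y * y) := by
    rw [eq_inv_smul_iff₀ h2, two_smul]
    simp only [add_mul, mul_add, mul_comm y x]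
    abel
  rw [SetLike.mem_coe, e]
  exact Submodule.smul_mem _ _ (sub_mem (sub_mem (Submodule.subset_span ⟨_, rfl⟩)
    (Submodule.subset_span ⟨_, rfl⟩)) (Submodule.subset_span ⟨_, rfl⟩))

/-- A property of the form `f a ∈ N`, with `f` linear, passes from squares to their span. -/
theorem mem_of_squares (h2 : (2 : K) ≠ 0) {N : Submodule K A} (f : A →ₗ[K] A)
    (hf : ∀ x, f (x * x) ∈ N) {a : A} (ha : a ∈ derivedSubspace K A 1) : f a ∈ N := by
  have h : Submodule.span K (Set.range fun x : A => x * x) ≤ N.comap f :=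
    Submodule.span_le.2 (by rintro _ ⟨x, rfl⟩; exact hf x)
  exact h (derivedSubspace_one_le h2 ha)

/-- The expression is linear in each of its four arguments and products are combinations of squares,
so `squares_mem_annihilator` extends one argument at a time. -/
theorem derived_mem_annihilator (h2 : (2 : K) ≠ 0) (h3 : (3 : K) ≠ 0)
    (hc : ∀ x y z : A, x * y * z + y * z * x + z * x * y = 0) {a b r : A}
    (ha : a ∈ derivedSubspace K A 1) (hb : b ∈ derivedSubspace K A 1)
    (hr : r ∈ derivedSubspace K A 2) : a * (b * r) - b * (a * r) ∈ annihilator K A := by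
  have s1 (y z t : A) : a * (y * y * (z * z * (t * t))) - y * y * (a * (z * z * (t * t)))
      ∈ annihilator K A := by
    have := mem_of_squares (N := annihilator K A) h2 (mulOp K (y * y * (z * z * (t * t)))
      - mulOp K (y * y) ∘ₗ mulOp K (z * z * (t * t))) (fun x => ?_) ha
    · simpa [mul_comm a] using this
    · simpa [mul_comm (x * x)] using squares_mem_annihilator h2 h3 hc x y z t
  have s2 (z t : A) : a * (b * (z * z * (t * t))) - b * (a * (z * z * (t * t)))
      ∈ annihilator K A := by
    have := mem_of_squares (N := annihilator K A) h2 (mulOp K a ∘ₗ mulOp K (z * z * (t * t))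
      - mulOp K (a * (z * z * (t * t)))) (fun y => ?_) hb
    · simpa [mul_comm b] using this
    · simpa [mul_comm (y * y)] using s1 y z t
  have key : ∀ c ∈ derivedSubspace K A 1, ∀ d ∈ derivedSubspace K A 1,
      a * (b * (c * d)) - b * (a * (c * d)) ∈ annihilator K A := by
    intro c hc' d hd
    refine mem_of_squares h2 (mulOp K a ∘ₗ mulOp K b ∘ₗ mulOp K c
      - mulOp K b ∘ₗ mulOp K a ∘ₗ mulOp K c) (fun t => ?_) hd
    have := mem_of_squares (N := annihilator K A) h2 (mulOp K a ∘ₗ mulOp K b ∘ₗ mulOp K (t * t)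
      - mulOp K b ∘ₗ mulOp K a ∘ₗ mulOp K (t * t)) (fun z => ?_) hc'
    · simpa [mul_comm c] using this
    · simpa [mul_comm (t * t)] using s2 z t
  have h : derivedSubspace K A 2 ≤ (annihilator K A).comap
      (mulOp K a ∘ₗ mulOp K b - mulOp K b ∘ₗ mulOp K a) := by
    refine Submodule.span_le.2 ?_
    rintro _ ⟨c, hc', d, hd, rfl⟩
    exact key c hc' d hd
  exact h hr

/-- Modulo the annihilator, `p (q r)` is unchanged by permutations of `p, q, r` in the second
derived term, while its cyclic sum is zero; hence `3 p (q r)` vanishes there. -/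
theorem derivedSubspace_four_le (h2 : (2 : K) ≠ 0) (h3 : (3 : K) ≠ 0)
    (hc : ∀ x y z : A, x * y * z + y * z * x + z * x * y = 0) :
    derivedSubspace K A 4 ≤ annihilator K A := by
  have key : ∀ p ∈ derivedSubspace K A 2, ∀ q ∈ derivedSubspace K A 2,
      ∀ r ∈ derivedSubspace K A 2, p * (q * r) ∈ annihilator K A := by
    intro p hp q hq r hr
    have hp' := derivedSubspace_succ_le _ hp
    have hq' := derivedSubspace_succ_le _ hq
    have hr' := derivedSubspace_succ_le _ hr
    have e1 := derived_mem_annihilator h2 h3 hc hp' hq' hr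
    have e2 := derived_mem_annihilator h2 h3 hc hp' hr' hq
    have e : p * (q * r) = (3⁻¹ : K) •
        ((p * (q * r) - q * (p * r)) + (p * (r * q) - r * (p * q))) := by
      rw [eq_inv_smul_iff₀ h3, show (3 : K) = 2 + 1 by norm_num, add_smul, one_smul, two_smul]
      have h := hc p q r
      rw [mul_comm (p * q) r, mul_comm (q * r) p, mul_comm (r * p) q, mul_comm r p] at h
      rw [← sub_eq_zero, ← h, mul_comm r q]
      abel
    rw [e]
    exact Submodule.smul_mem _ _ (add_mem e1 e2)
  refine Submodule.span_le.2 ?_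
  rintro _ ⟨x, hx, y, hy, rfl⟩
  have h : derivedSubspace K A 3 ≤ (annihilator K A).comap (mulOp K x) := by
    refine Submodule.span_le.2 ?_
    rintro _ ⟨c, hc', d, hd, rfl⟩
    exact key x (derivedSubspace_succ_le _ hx) c hc' d hd
  exact h hy

end CubeZero

/-! ### Nilpotency of finitely generated algebras with vanishing cubes -/

section Generation

set_option linter.unusedSectionVars false

variable {K : Type u} {A : Type v} [Field K] [NonUnitalNonAssocCommRing A] [Module K A]
  [IsScalarTower K A A] [SMulCommClass K A A]

/-- Eliminate the elements of `X` one by one. Each elimination only creates letters in the next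
derived term; these accumulate in the finite set `Y`, which is why the induction must quantify over
all `Y`. -/
theorem wordsVanish_of_derived (h2 : (2 : K) ≠ 0) (h3 : (3 : K) ≠ 0)
    (hc : ∀ x y z : A, x * y * z + y * z * x + z * x * y = 0) (n : ℕ)
    (h : ∀ Y : Set A, Y.Finite → Y ⊆ derivedSubspace K A (n + 1) → WordsVanish (mulOp K '' Y))
    {X : Set A} (hX : X.Finite) (hXn : X ⊆ derivedSubspace K A n) :
    WordsVanish (mulOp K '' X) := by
  have key : ∀ Y : Set A, Y.Finite → Y ⊆ derivedSubspace K A (n + 1) →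
      WordsVanish (mulOp K '' (X ∪ Y)) := by
    induction X, hX using Set.Finite.induction_on with
    | empty => intro Y hY hYn; rw [Set.empty_union]; exact h Y hY hYn
    | @insert a X _ hX ih =>
      intro Y hY hYn
      have ha : a ∈ derivedSubspace K A n := hXn (Set.mem_insert _ _)
      have hX' : X ⊆ derivedSubspace K A n := (Set.subset_insert _ _).trans hXn
      have hXY : X ∪ Y ⊆ derivedSubspace K A n :=
        Set.union_subset hX' (hYn.trans (derivedSubspace_succ_le n))
      -- The scalars make these elements represent the new letters exactly: `L_b ∘ L_a = L_{-(ba)}`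
      -- and `L_b ∘ L_a² = L_{(1/2) b a²}`, where `∘` is the Jordan product.
      have hvan := ih hX' (Y ∪ ((fun b => -(b * a)) '' (X ∪ Y) ∪
          (fun b => (2⁻¹ : K) • (b * (a * a))) '' (X ∪ Y)))
        (hY.union (((hX.union hY).image _).union ((hX.union hY).image _))) (by
          refine Set.union_subset hYn (Set.union_subset ?_ ?_)
          · rintro _ ⟨b, hb, rfl⟩
            exact neg_mem (mul_mem_derivedSubspace (hXY hb) ha)
          · rintro _ ⟨b, hb, rfl⟩
            exact Submodule.smul_mem _ _ (mul_mem_derivedSubspace (hXY hb)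
              (derivedSubspace_succ_le n (mul_mem_derivedSubspace ha ha))))
      rw [Set.insert_union, Set.image_insert_eq]
      refine WordsVanish.insert_of_elimination (mulOp_cube h2 h3 hc a) (hvan.mono ?_)
      rintro _ ⟨_, ⟨b, hb, rfl⟩, rfl | rfl | rfl⟩
      · refine ⟨b, ?_, rfl⟩
        rcases hb with hb | hb
        · exact .inl hb
        · exact .inr (.inl hb)
      · refine ⟨-(b * a), .inr (.inr (.inl ⟨b, hb, rfl⟩)), ?_⟩
        rw [mulOp_neg, mulOp_mul hc, neg_neg]
      · refine ⟨(2⁻¹ : K) • (b * (a * a)), .inr (.inr (.inr ⟨b, hb, rfl⟩)), ?_⟩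
        rw [mulOp_smul, inv_smul_eq_iff₀ h2, mulOp_mul hc, mulOp_mul hc, two_smul]
        noncomm_ring
  simpa using key ∅ Set.finite_empty (Set.empty_subset _)

/-- Words in finitely many multiplication operators of a commutative algebra with vanishing cubes
vanish once they are long enough. -/
theorem wordsVanish_of_finite (h2 : (2 : K) ≠ 0) (h3 : (3 : K) ≠ 0)
    (hc : ∀ x y z : A, x * y * z + y * z * x + z * x * y = 0) {X : Set A} (hX : X.Finite) :
    WordsVanish (mulOp K '' X) := by
  have h4 : ∀ Y : Set A, Y.Finite → Y ⊆ derivedSubspace K A 4 → WordsVanish (mulOp K '' Y) := by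
    intro Y _ hY
    refine ⟨1, fun w hw hl => ?_⟩
    obtain ⟨s, rfl⟩ := List.length_eq_one_iff.1 hl
    obtain ⟨y, hy, rfl⟩ := hw s (by simp)
    simpa using mem_annihilator.1 (derivedSubspace_four_le h2 h3 hc (hY hy))
  have h3' := fun (Y : Set A) hY => wordsVanish_of_derived h2 h3 hc 3 h4 (X := Y) hY
  have h2' := fun (Y : Set A) hY => wordsVanish_of_derived h2 h3 hc 2 h3' (X := Y) hY
  have h1' := fun (Y : Set A) hY => wordsVanish_of_derived h2 h3 hc 1 h2' (X := Y) hY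
  exact wordsVanish_of_derived h2 h3 hc 0 h1' hX (fun _ _ => Submodule.mem_top)

variable (K) in
/-- The subspace spanned by the values of the monomials of degree at least `d`. -/
def degreeSpan {ι : Type*} (g : ι → A) (d : ℕ) : Submodule K A :=
  Submodule.span K {r | ∃ p : FreeMagma ι, d ≤ p.length ∧ r = FreeMagma.lift g p}

theorem mul_mem_degreeSpan {ι : Type*} {g : ι → A} {i j : ℕ} {x y : A}
    (hx : x ∈ degreeSpan K g i) (hy : y ∈ degreeSpan K g j) :
    x * y ∈ degreeSpan K g (i + j) := by
  induction hx using Submodule.span_induction with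
  | zero => rw [zero_mul]; exact zero_mem _
  | add a b _ _ ha hb => rw [add_mul]; exact add_mem ha hb
  | smul c a _ ha => rw [smul_mul_assoc]; exact Submodule.smul_mem _ _ ha
  | mem x hx =>
    obtain ⟨p, hp, rfl⟩ := hx
    induction hy using Submodule.span_induction with
    | zero => rw [mul_zero]; exact zero_mem _
    | add a b _ _ ha hb => rw [mul_add]; exact add_mem ha hb
    | smul c a _ ha => rw [mul_smul_comm]; exact Submodule.smul_mem _ _ ha
    | mem y hy =>
      obtain ⟨q, hq, rfl⟩ := hy
      exact Submodule.subset_span ⟨p * q, Nat.add_le_add hp hq, (map_mul _ _ _).symm⟩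

theorem degreeSpan_anti {ι : Type*} (g : ι → A) {i j : ℕ} (h : i ≤ j) :
    degreeSpan K g j ≤ degreeSpan K g i := by
  refine Submodule.span_mono ?_
  rintro _ ⟨p, hp, rfl⟩
  exact ⟨p, h.trans hp, rfl⟩

theorem degreeSpan_one_eq_top {ι : Type*} {g : ι → A}
    (hg : NonUnitalAlgebra.adjoin K (Set.range g) = ⊤) : degreeSpan K g 1 = ⊤ := by
  refine eq_top_iff.2 fun x _ => ?_
  have hx : x ∈ NonUnitalAlgebra.adjoin K (Set.range g) := hg ▸ NonUnitalAlgebra.mem_top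
  induction hx using NonUnitalAlgebra.adjoin_induction with
  | mem x hx =>
    obtain ⟨i, rfl⟩ := hx
    exact Submodule.subset_span ⟨FreeMagma.of i, le_rfl, (FreeMagma.lift_of g i).symm⟩
  | add a b _ _ ha hb => exact add_mem (ha trivial) (hb trivial)
  | zero => exact zero_mem _
  | mul a b _ _ ha hb =>
    exact degreeSpan_anti g (by norm_num) (mul_mem_degreeSpan (ha trivial) (hb trivial))
  | smul c a _ ha => exact Submodule.smul_mem _ _ (ha trivial)

/-- Every element is a combination of monomials of degree at least one in the generators, so a
product of `N` elements is a combination of monomials of degree at least `N`. -/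
theorem productsVanish_of_degreeSpan {ι : Type*} {g : ι → A}
    (hg : NonUnitalAlgebra.adjoin K (Set.range g) = ⊤) {N : ℕ}
    (hN : ∀ p : FreeMagma ι, N ≤ p.length → FreeMagma.lift g p = 0) : ProductsVanish A N := by
  have key (p : FreeMagma A) : FreeMagma.lift id p ∈ degreeSpan K g p.length := by
    induction p with
    | ih1 a =>
      change FreeMagma.lift id (FreeMagma.of a) ∈ degreeSpan K g 1
      rw [degreeSpan_one_eq_top hg]
      trivial
    | ih2 p q hp hq => rw [map_mul]; exact mul_mem_degreeSpan hp hq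
  intro p hp
  have h : degreeSpan K g N ≤ ⊥ := by
    refine Submodule.span_le.2 ?_
    rintro _ ⟨q, hq, rfl⟩
    exact hN q hq
  exact (Submodule.mem_bot K).1 (h (degreeSpan_anti g hp (key p)))

theorem exists_isNilpotencyIndex {B : Type*} [Mul B] [Zero B] {N : ℕ} (h1 : 1 ≤ N)
    (h : ProductsVanish B N) : ∃ m ≤ N, IsNilpotencyIndex B m := by
  classical
  have hex : ∃ j, 1 ≤ j ∧ ProductsVanish B j := ⟨N, h1, h⟩
  exact ⟨Nat.find hex, Nat.find_min' hex ⟨h1, h⟩, Nat.find_spec hex, fun j hj =>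
    Nat.find_min' hex hj⟩

/-- A finitely generated commutative algebra with vanishing cubes is nilpotent. -/
theorem exists_productsVanish_of_cube_zero (h2 : (2 : K) ≠ 0) (h3 : (3 : K) ≠ 0)
    (h : ∀ x : A, x * x * x = 0) {ι : Type*} [Finite ι] {g : ι → A}
    (hg : NonUnitalAlgebra.adjoin K (Set.range g) = ⊤) : ∃ N, 1 ≤ N ∧ ProductsVanish A N := by
  have hc := cyclic_of_cube_zero h2 h
  obtain ⟨m, hm⟩ := wordsVanish_of_finite h2 h3 hc (Set.finite_range g)
  let W (l : ℕ) : Submodule K (Module.End K A) := Submodule.span K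
    {r | ∃ w : List (Module.End K A), (∀ s ∈ w, s ∈ mulOp K '' Set.range g) ∧ w.length = l ∧
      r = w.prod}
  have W_mul (i j : ℕ) (x y) (hx : x ∈ W i) (hy : y ∈ W j) : x * y ∈ W (i + j) := by
    induction hx using Submodule.span_induction with
    | zero => rw [zero_mul]; exact zero_mem _
    | add a b _ _ ha hb => rw [add_mul]; exact add_mem ha hb
    | smul c a _ ha => rw [smul_mul_assoc]; exact Submodule.smul_mem _ _ ha
    | mem x hx =>
      obtain ⟨p, hp, hpl, rfl⟩ := hx
      induction hy using Submodule.span_induction with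
      | zero => rw [mul_zero]; exact zero_mem _
      | add a b _ _ ha hb => rw [mul_add]; exact add_mem ha hb
      | smul c a _ ha => rw [mul_smul_comm]; exact Submodule.smul_mem _ _ ha
      | mem y hy =>
        obtain ⟨q, hq, hql, rfl⟩ := hy
        refine Submodule.subset_span ⟨p ++ q, fun s hs => ?_, by simp [hpl, hql],
          List.prod_append.symm⟩
        exact (List.mem_append.1 hs).elim (hp s) (hq s)
  -- By `mulOp_mul`, multiplication by a monomial of degree `d` is a combination of words of length
  -- `d` in the operators of the generators.
  have hW (p : FreeMagma ι) : mulOp K (FreeMagma.lift g p) ∈ W p.length := by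
    induction p with
    | ih1 i =>
      exact Submodule.subset_span ⟨[mulOp K (g i)], by simp, rfl, by
        rw [FreeMagma.lift_of, List.prod_singleton]⟩
    | ih2 p q hp hq =>
      rw [map_mul, mulOp_mul hc]
      have h := W_mul _ _ _ _ hq hp
      rw [Nat.add_comm] at h
      exact neg_mem (add_mem (W_mul _ _ _ _ hp hq) h)
  have hzero (p : FreeMagma ι) (hp : m ≤ p.length) : mulOp K (FreeMagma.lift g p) = 0 := by
    have : W p.length ≤ ⊥ := by
      refine Submodule.span_le.2 ?_
      rintro _ ⟨w, hw, hl, rfl⟩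
      change w.prod = 0
      rw [← List.take_append_drop m w, List.prod_append,
        hm _ (fun s hs => hw s (List.mem_of_mem_take hs)) (by simp; omega), zero_mul]
    exact (Submodule.mem_bot K).1 (this (hW p))
  -- At this degree the monomial is a genuine product, and one of its two factors has degree at
  -- least `m`.
  refine ⟨2 * m + 2, by omega, productsVanish_of_degreeSpan hg fun p hp => ?_⟩
  cases p with
  | of i => simp [FreeMagma.length] at hp
  | mul p q =>
    change FreeMagma.lift g (p * q) = 0
    rw [map_mul]
    change 2 * m + 2 ≤ p.length + q.length at hp
    rcases le_total m p.length with h | h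
    · exact LinearMap.congr_fun (hzero p h) _
    · rw [mul_comm]
      exact LinearMap.congr_fun (hzero q (by omega)) _

end Generation

/-! ### Algebras with `L_x ^ 3 = (1 / 2) L_{x ^ 3}` -/

section HalfCube

set_option linter.unusedSectionVars false

variable {K : Type u} {A : Type v} [Field K] [NonUnitalNonAssocCommRing A] [Module K A]
  [IsScalarTower K A A] [SMulCommClass K A A]

/-- The linearized form of the identity `L_x ^ 3 = (1 / 2) L_{x ^ 3}`. -/
def halfCubeDefect (x y z w : A) : A :=
  x * (y * (z * w)) + x * (z * (y * w)) + y * (z * (x * w)) + y * (x * (z * w))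
    + z * (x * (y * w)) + z * (y * (x * w)) - (x * y * z + y * z * x + z * x * y) * w

theorem halfCubeDefect_eq_zero (h2 : (2 : K) ≠ 0) (h : SatisfiesHalfCubeIdentity K A)
    (x y z w : A) : halfCubeDefect x y z w = 0 := by
  have h' (x : A) : x * (x * (x * w)) + x * (x * (x * w)) - x * x * x * w = 0 := by
    have e := LinearMap.congr_fun (h x) w
    simp only [pow_succ, pow_zero, one_mul, Module.End.mul_apply, LinearMap.mulLeft_apply,
      LinearMap.smul_apply, one_div] at e
    rw [eq_inv_smul_iff₀ h2, two_smul] at e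
    rw [e, sub_self]
  refine eq_zero_of_two_smul h2 ?_
  have e : halfCubeDefect x y z w + halfCubeDefect x y z w =
      ((x + y + z) * ((x + y + z) * ((x + y + z) * w))
        + (x + y + z) * ((x + y + z) * ((x + y + z) * w))
        - (x + y + z) * (x + y + z) * (x + y + z) * w)
      - ((x + y) * ((x + y) * ((x + y) * w)) + (x + y) * ((x + y) * ((x + y) * w))
        - (x + y) * (x + y) * (x + y) * w)
      - ((y + z) * ((y + z) * ((y + z) * w)) + (y + z) * ((y + z) * ((y + z) * w))
        - (y + z) * (y + z) * (y + z) * w)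
      - ((x + z) * ((x + z) * ((x + z) * w)) + (x + z) * ((x + z) * ((x + z) * w))
        - (x + z) * (x + z) * (x + z) * w)
      + (x * (x * (x * w)) + x * (x * (x * w)) - x * x * x * w)
      + (y * (y * (y * w)) + y * (y * (y * w)) - y * y * y * w)
      + (z * (z * (z * w)) + z * (z * (z * w)) - z * z * z * w) := by
    simp only [halfCubeDefect, add_mul, mul_add, mul_comm y x, mul_comm z x, mul_comm z y]
    abel
  rw [two_smul, e]
  simp only [h']
  abel

/-- An explicit certificate: the product of two cubes is, up to the factor `12`, a combination of
consequences of the linearized identity of degree three in `x` and in `y`. -/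
theorem cube_mul_cube_eq (x y : A) : (12 : ℤ) • (x * x * x * (y * y * y)) =
      (2 : ℤ) • (x * (x * halfCubeDefect y y y x))
        + (-6 : ℤ) • (halfCubeDefect y x ((x * y) * x) y)
        + (-6 : ℤ) • (y * halfCubeDefect y x (x * x) y)
        + (3 : ℤ) • (halfCubeDefect y x ((y * y) * x) x)
        + (3 : ℤ) • (x * (x * halfCubeDefect y y x y))
        + (-3 : ℤ) • (y * halfCubeDefect y y x (x * x))
        + (18 : ℤ) • (y * (y * halfCubeDefect y x x x))
        + (-6 : ℤ) • (y * halfCubeDefect y y (x * x) x)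
        + (-3 : ℤ) • (halfCubeDefect y y x ((x * x) * y))
        + (-4 : ℤ) • (halfCubeDefect y y y ((x * x) * x))
        + (12 : ℤ) • (y * halfCubeDefect y x (x * y) x)
        + (-6 : ℤ) • (halfCubeDefect y y ((x * y) * x) x)
        + (-6 : ℤ) • (halfCubeDefect y y ((x * x) * y) x)
        + (-6 : ℤ) • (halfCubeDefect y x ((x * x) * y) y)
        + (-3 : ℤ) • (halfCubeDefect y y x ((x * y) * x))
        + (3 : ℤ) • (y * (x * halfCubeDefect y y x x))
        + (12 : ℤ) • (halfCubeDefect y x ((x * y) * y) x) := by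
  simp only [halfCubeDefect, mul_add, mul_sub, mul_comm]
  abel

/-- The cubes `(x x) x` and `(y y) y` annihilate each other. -/
theorem cube_mul_cube (h2 : (2 : K) ≠ 0) (h3 : (3 : K) ≠ 0) (h : SatisfiesHalfCubeIdentity K A)
    (x y : A) : x * x * x * (y * y * y) = 0 := by
  refine smul_eq_zero_of_two_three h2 h3 2 1 ?_
  have e := cube_mul_cube_eq x y
  simp only [halfCubeDefect_eq_zero h2 h, mul_zero, smul_zero, add_zero] at e
  exact_mod_cast e

variable (K A) in
/-- The subspace spanned by the cubes. -/
def cubeSpan : Submodule K A := Submodule.span K (Set.range fun x : A => x * x * x)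

theorem cyclic_mem_cubeSpan (h2 : (2 : K) ≠ 0) (x y z : A) :
    x * y * z + y * z * x + z * x * y ∈ cubeSpan K A := by
  have hmem (x : A) : x * x * x ∈ cubeSpan K A := Submodule.subset_span ⟨x, rfl⟩
  have e : x * y * z + y * z * x + z * x * y = (2⁻¹ : K) •
      ((x + y + z) * (x + y + z) * (x + y + z) - (x + y) * (x + y) * (x + y)
        - (y + z) * (y + z) * (y + z) - (x + z) * (x + z) * (x + z)
        + x * x * x + y * y * y + z * z * z) := by
    rw [eq_inv_smul_iff₀ h2, two_smul]
    simp only [add_mul, mul_add, mul_comm y x, mul_comm z x, mul_comm z y]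
    abel
  rw [e]
  exact Submodule.smul_mem _ _ (add_mem (add_mem (add_mem (sub_mem (sub_mem (sub_mem (hmem _)
    (hmem _)) (hmem _)) (hmem _)) (hmem _)) (hmem _)) (hmem _))

/-- Modulo the linearized identity, `6 y x³` is a combination of two linearized cubes, at `(x, x, x
y)` and at `(x, y, x²)`. So the cubes span an ideal. -/
theorem mul_mem_cubeSpan (h2 : (2 : K) ≠ 0) (h3 : (3 : K) ≠ 0)
    (h : SatisfiesHalfCubeIdentity K A) (y : A) {c : A} (hc : c ∈ cubeSpan K A) :
    y * c ∈ cubeSpan K A := by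
  have key : cubeSpan K A ≤ (cubeSpan K A).comap (mulOp K y) := by
    refine Submodule.span_le.2 ?_
    rintro _ ⟨x, rfl⟩
    change y * (x * x * x) ∈ cubeSpan K A
    have e : (6 : ℤ) • (y * (x * x * x)) =
        (3 : ℤ) • ((x * x * (x * y) + x * (x * y) * x + x * y * x * x)
          - (x * x * x * y + x * y * (x * x) + y * (x * x) * x))
        + ((3 : ℤ) • halfCubeDefect x x y x - halfCubeDefect x x x y) := by
      simp only [halfCubeDefect, mul_add, mul_comm]
      abel
    rw [halfCubeDefect_eq_zero h2 h, halfCubeDefect_eq_zero h2 h, smul_zero, sub_zero, add_zero,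
      ← Int.cast_smul_eq_zsmul K] at e
    have h6 : ((6 : ℤ) : K) ≠ 0 := by
      have : ((6 : ℤ) : K) = 2 * 3 := by norm_num
      rw [this]
      exact mul_ne_zero h2 h3
    refine ((cubeSpan K A).smul_mem_iff h6).1 ?_
    rw [e]
    exact zsmul_mem (sub_mem (cyclic_mem_cubeSpan h2 _ _ _) (cyclic_mem_cubeSpan h2 _ _ _)) _
  exact key hc

theorem cubeSpan_mul_cubeSpan (h2 : (2 : K) ≠ 0) (h3 : (3 : K) ≠ 0)
    (h : SatisfiesHalfCubeIdentity K A) {c d : A} (hc : c ∈ cubeSpan K A)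
    (hd : d ∈ cubeSpan K A) : c * d = 0 := by
  induction hc using Submodule.span_induction with
  | zero => exact zero_mul _
  | add a b _ _ ha hb => rw [add_mul, ha, hb, add_zero]
  | smul r a _ ha => rw [smul_mul_assoc, ha, smul_zero]
  | mem c hc =>
    obtain ⟨x, rfl⟩ := hc
    induction hd using Submodule.span_induction with
    | zero => exact mul_zero _
    | add a b _ _ ha hb => rw [mul_add, ha, hb, add_zero]
    | smul r a _ ha => rw [mul_smul_comm, ha, smul_zero]
    | mem d hd =>
      obtain ⟨y, rfl⟩ := hd
      exact cube_mul_cube h2 h3 h x y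

/-- Three instances of the linearized identity, with `w`, `y` and `z` in turn as the last argument,
are added and read as an operator on `w`. Products of three operators then become words of length at
most two. -/
theorem mul_mul_eq_of_halfCube (h2 : (2 : K) ≠ 0) (h : SatisfiesHalfCubeIdentity K A)
    (x y z : A) :
    (2 : ℤ) • (mulOp K x * mulOp K y * mulOp K z) + (2 : ℤ) • (mulOp K x * mulOp K z * mulOp K y)
      + mulOp K y * mulOp K x * mulOp K z + mulOp K z * mulOp K x * mulOp K y
      = -mulOp K (x * (y * z)) - (2 : ℤ) • (mulOp K x * mulOp K (y * z)) := by
  ext w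
  rw [← sub_eq_zero]
  have e : halfCubeDefect x y z w + halfCubeDefect x z w y + halfCubeDefect x y w z = 0 := by
    simp only [halfCubeDefect_eq_zero h2 h, add_zero]
  rw [← e]
  simp only [LinearMap.mulLeft_apply, LinearMap.neg_apply, LinearMap.add_apply,
    LinearMap.sub_apply, LinearMap.smul_apply, Module.End.mul_apply, halfCubeDefect, mul_add,
    mul_comm]
  abel

end HalfCube

/-! ### Words with a letter that occurs three times -/

section WordSpan

variable {K : Type*} {R : Type*} {M : Type*} [Field K] [Ring R] [Algebra K R]

variable (K) in
/-- The subspace spanned by the words of length at most `m` and of total degree at least `d`. -/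
def wordSpan (O : M → R) (δ : M → ℕ) (d m : ℕ) : Submodule K R :=
  Submodule.span K {r | ∃ w : List M, w.length ≤ m ∧ d ≤ (w.map δ).sum ∧ r = (w.map O).prod}

variable {O : M → R} {δ : M → ℕ}

theorem wordSpan_mono {d m d' m' : ℕ} (hd : d' ≤ d) (hm : m ≤ m') :
    wordSpan K O δ d m ≤ wordSpan K O δ d' m' := by
  refine Submodule.span_mono ?_
  rintro _ ⟨w, hl, hw, rfl⟩
  exact ⟨w, hl.trans hm, hd.trans hw, rfl⟩

theorem prod_mem_wordSpan (w : List M) {d m : ℕ} (hd : d ≤ (w.map δ).sum) (hm : w.length ≤ m) :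
    (w.map O).prod ∈ wordSpan K O δ d m :=
  Submodule.subset_span ⟨w, hm, hd, rfl⟩

theorem letter_mem_wordSpan (x : M) : O x ∈ wordSpan K O δ (δ x) 1 := by
  simpa using prod_mem_wordSpan (K := K) (O := O) (δ := δ) [x] (by simp) le_rfl

theorem mul_mem_wordSpan {d m d' m' D N : ℕ} {a b : R} (ha : a ∈ wordSpan K O δ d m)
    (hb : b ∈ wordSpan K O δ d' m') (hD : D ≤ d + d') (hN : m + m' ≤ N) :
    a * b ∈ wordSpan K O δ D N := by
  induction ha using Submodule.span_induction with
  | zero => rw [zero_mul]; exact zero_mem _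
  | add a b _ _ ha hb => rw [add_mul]; exact add_mem ha hb
  | smul c a _ ha => rw [smul_mul_assoc]; exact Submodule.smul_mem _ _ ha
  | mem x hx =>
    obtain ⟨p, hp, hpd, rfl⟩ := hx
    induction hb using Submodule.span_induction with
    | zero => rw [mul_zero]; exact zero_mem _
    | add a b _ _ ha hb => rw [mul_add]; exact add_mem ha hb
    | smul c a _ ha => rw [mul_smul_comm]; exact Submodule.smul_mem _ _ ha
    | mem y hy =>
      obtain ⟨q, hq, hqd, rfl⟩ := hy
      rw [← List.prod_append, ← List.map_append]
      refine prod_mem_wordSpan _ ?_ ?_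
      · rw [List.map_append, List.sum_append]; omega
      · rw [List.length_append]; omega

variable (K) in
/-- Modulo shorter words of at least the same degree, three letters satisfy the relation
`2 x y z + 2 x z y + y x z + z x y = 0`. -/
def ReducesTriples (O : M → R) (δ : M → ℕ) : Prop :=
  ∀ x y z : M, 2 * (O x * O y * O z) + 2 * (O x * O z * O y) + O y * O x * O z + O z * O x * O y ∈
    wordSpan K O δ (δ x + δ y + δ z) 2

namespace ReducesTriples

theorem mem_of_two_mul (h2 : (2 : K) ≠ 0) {S : Submodule K R} {r : R} (h : 2 * r ∈ S) : r ∈ S := by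
  refine (S.smul_mem_iff h2).1 ?_
  rwa [two_smul, ← two_mul]

theorem mem_of_three_mul (h3 : (3 : K) ≠ 0) {S : Submodule K R} {r : R} (h : 3 * r ∈ S) :
    r ∈ S := by
  refine (S.smul_mem_iff h3).1 ?_
  have e : (3 : K) • r = 3 * r := by
    rw [Algebra.smul_def, map_ofNat]
  rwa [e]

theorem two_mul_mem {S : Submodule K R} {r : R} (h : r ∈ S) : 2 * r ∈ S := by
  rw [two_mul]; exact add_mem h h

/-- With `A(x,y,z)` the left side of the defining relation, `A(x,y,z) + A(y,z,x) - 2 A(z,x,y) = 3 [x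
∘ y, z]`. Jordan products of letters are thus central modulo shorter words. -/
theorem sum_swap_comm_mem (h3 : (3 : K) ≠ 0) (hA : ReducesTriples K O δ) (x y z : M) :
    (O x * O y + O y * O x) * O z - O z * (O x * O y + O y * O x) ∈
      wordSpan K O δ (δ x + δ y + δ z) 2 := by
  refine mem_of_three_mul h3 ?_
  have hx := hA x y z
  have hy := wordSpan_mono (d' := δ x + δ y + δ z) (by omega) le_rfl (hA y z x)
  have hz := two_mul_mem (wordSpan_mono (d' := δ x + δ y + δ z) (by omega) le_rfl (hA z x y))
  have h := sub_mem (add_mem hx hy) hz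
  convert h using 1
  noncomm_ring

theorem sum_swap_mul_mem (h2 : (2 : K) ≠ 0) (h3 : (3 : K) ≠ 0) (hA : ReducesTriples K O δ)
    (x y : M) :
    (O x * O y + O y * O x) * O x + O x * O x * O y ∈ wordSpan K O δ (2 * δ x + δ y) 2 := by
  refine mem_of_two_mul h2 (mem_of_three_mul h3 ?_)
  have hx := two_mul_mem (wordSpan_mono (d' := 2 * δ x + δ y) (by omega) le_rfl (hA x x y))
  have hy := wordSpan_mono (d' := 2 * δ x + δ y) (by omega) le_rfl (hA y x x)
  have h := add_mem hx hy
  convert h using 1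
  noncomm_ring

theorem cube_mem (h2 : (2 : K) ≠ 0) (h3 : (3 : K) ≠ 0) (hA : ReducesTriples K O δ) (x : M) :
    O x * O x * O x ∈ wordSpan K O δ (3 * δ x) 2 := by
  refine mem_of_two_mul h2 (mem_of_three_mul h3 ?_)
  have hx := wordSpan_mono (d' := 3 * δ x) (by omega) le_rfl (hA x x x)
  convert hx using 1
  noncomm_ring

theorem sum_swap_comm_word_mem (h3 : (3 : K) ≠ 0) (hA : ReducesTriples K O δ) (x y : M)
    (w : List M) : (O x * O y + O y * O x) * (w.map O).prod
      - (w.map O).prod * (O x * O y + O y * O x) ∈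
      wordSpan K O δ (δ x + δ y + (w.map δ).sum) (w.length + 1) := by
  induction w with
  | nil => simp
  | cons z w ih =>
    have e : (O x * O y + O y * O x) * ((z :: w).map O).prod
        - ((z :: w).map O).prod * (O x * O y + O y * O x) =
        ((O x * O y + O y * O x) * O z - O z * (O x * O y + O y * O x)) * (w.map O).prod
        + O z * ((O x * O y + O y * O x) * (w.map O).prod
          - (w.map O).prod * (O x * O y + O y * O x)) := by
      rw [List.map_cons, List.prod_cons]
      noncomm_ring
    rw [e, List.map_cons, List.sum_cons, List.length_cons]
    exact add_mem (mul_mem_wordSpan (sum_swap_comm_mem h3 hA x y z)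
        (prod_mem_wordSpan w le_rfl le_rfl) (by omega) (by omega))
      (mul_mem_wordSpan (letter_mem_wordSpan z) ih (by omega) (by omega))

theorem sq_comm_mem (h2 : (2 : K) ≠ 0) (h3 : (3 : K) ≠ 0) (hA : ReducesTriples K O δ) (x : M)
    (w : List M) : O x * O x * (w.map O).prod - (w.map O).prod * (O x * O x) ∈
      wordSpan K O δ (2 * δ x + (w.map δ).sum) (w.length + 1) := by
  refine mem_of_two_mul h2 ?_
  have h := wordSpan_mono (d' := 2 * δ x + (w.map δ).sum) (by omega) le_rfl
    (sum_swap_comm_word_mem h3 hA x x w)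
  convert h using 1
  noncomm_ring

/-- Modulo shorter words, `x y w x = (x ∘ y) w x - y x w x`. The first term is `w (x ∘ y) x = -w x²
y = -x² w y` by centrality and `sum_swap_mul_mem`; the second is `y x² Z = x² y Z` by induction.
This dictates the witness `-w y - y Z`. -/
theorem sandwich_word (h2 : (2 : K) ≠ 0) (h3 : (3 : K) ≠ 0) (hA : ReducesTriples K O δ) (x : M)
    (w : List M) : ∃ Z ∈ wordSpan K O δ (w.map δ).sum w.length,
      O x * (w.map O).prod * O x - O x * O x * Z ∈
        wordSpan K O δ (2 * δ x + (w.map δ).sum) (w.length + 1) := by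
  induction w with
  | nil => exact ⟨1, prod_mem_wordSpan [] (by simp) (by simp), by simp⟩
  | cons y w ih =>
    obtain ⟨Z, hZ, h⟩ := ih
    have hw := prod_mem_wordSpan (K := K) (O := O) (δ := δ) w le_rfl le_rfl
    have hy := letter_mem_wordSpan (K := K) (O := O) (δ := δ) y
    have hZ' : O x * O x * O y - O y * (O x * O x) ∈ wordSpan K O δ (2 * δ x + δ y) 2 := by
      simpa using sq_comm_mem h2 h3 hA x [y]
    have e : O x * ((y :: w).map O).prod * O x
        - O x * O x * (-((w.map O).prod * O y) - O y * Z) =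
        ((O x * O y + O y * O x) * (w.map O).prod
          - (w.map O).prod * (O x * O y + O y * O x)) * O x
        + (w.map O).prod * ((O x * O y + O y * O x) * O x + O x * O x * O y)
        + (O x * O x * (w.map O).prod - (w.map O).prod * (O x * O x)) * O y
        - O y * (O x * (w.map O).prod * O x - O x * O x * Z)
        + (O x * O x * O y - O y * (O x * O x)) * Z := by
      rw [List.map_cons, List.prod_cons]
      noncomm_ring
    refine ⟨-((w.map O).prod * O y) - O y * Z, ?_, ?_⟩
    · rw [List.map_cons, List.sum_cons, List.length_cons]
      exact sub_mem (neg_mem (mul_mem_wordSpan hw hy (by omega) (by omega)))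
        (mul_mem_wordSpan hy hZ (by omega) (by omega))
    · rw [e, List.map_cons, List.sum_cons, List.length_cons]
      refine add_mem (sub_mem (add_mem (add_mem ?_ ?_) ?_) ?_) ?_
      · exact mul_mem_wordSpan (sum_swap_comm_word_mem h3 hA x y w) (letter_mem_wordSpan x)
          (by omega) (by omega)
      · exact mul_mem_wordSpan hw (sum_swap_mul_mem h2 h3 hA x y) (by omega) (by omega)
      · exact mul_mem_wordSpan (sq_comm_mem h2 h3 hA x w) hy (by omega) (by omega)
      · exact mul_mem_wordSpan hy h (by omega) (by omega)
      · exact mul_mem_wordSpan hZ' hZ (by omega) (by omega)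

theorem sandwich (h2 : (2 : K) ≠ 0) (h3 : (3 : K) ≠ 0) (hA : ReducesTriples K O δ) (x : M)
    {d m : ℕ} {Y : R} (hY : Y ∈ wordSpan K O δ d m) : ∃ Z ∈ wordSpan K O δ d m,
      O x * Y * O x - O x * O x * Z ∈ wordSpan K O δ (2 * δ x + d) (m + 1) := by
  induction hY using Submodule.span_induction with
  | zero => exact ⟨0, zero_mem _, by simp⟩
  | add a b _ _ ha hb =>
    obtain ⟨Z, hZ, h⟩ := ha
    obtain ⟨Z', hZ', h'⟩ := hb
    refine ⟨Z + Z', add_mem hZ hZ', ?_⟩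
    convert add_mem h h' using 1
    noncomm_ring
  | smul c a _ ha =>
    obtain ⟨Z, hZ, h⟩ := ha
    refine ⟨c • Z, Submodule.smul_mem _ _ hZ, ?_⟩
    convert Submodule.smul_mem _ c h using 1
    rw [mul_smul_comm, smul_mul_assoc, mul_smul_comm, smul_sub]
  | mem Y hY =>
    obtain ⟨w, hl, hd, rfl⟩ := hY
    obtain ⟨Z, hZ, h⟩ := sandwich_word h2 h3 hA x w
    exact ⟨Z, wordSpan_mono hd hl hZ, wordSpan_mono (by omega) (by omega) h⟩

/-- Two applications of `sandwich` collect the three copies of `x` at the left as `x ^ 3`, which is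
itself a combination of shorter words. -/
theorem three_occurrences (h2 : (2 : K) ≠ 0) (h3 : (3 : K) ≠ 0) (hA : ReducesTriples K O δ)
    (x : M) {d m d' m' : ℕ} {Y Z : R} (hY : Y ∈ wordSpan K O δ d m)
    (hZ : Z ∈ wordSpan K O δ d' m') :
    O x * Y * O x * Z * O x ∈ wordSpan K O δ (3 * δ x + d + d') (m + m' + 2) := by
  obtain ⟨Y', hY', h⟩ := sandwich h2 h3 hA x hY
  obtain ⟨Z', hZ', h'⟩ := sandwich h2 h3 hA x (mul_mem_wordSpan hY' hZ le_rfl le_rfl)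
  have hx := letter_mem_wordSpan (K := K) (O := O) (δ := δ) x
  have e : O x * Y * O x * Z * O x = (O x * Y * O x - O x * O x * Y') * (Z * O x)
      + O x * (O x * (Y' * Z) * O x - O x * O x * Z') + O x * O x * O x * Z' := by
    noncomm_ring
  rw [e]
  exact add_mem (add_mem
    (mul_mem_wordSpan h (mul_mem_wordSpan hZ hx le_rfl le_rfl) (by omega) (by omega))
    (mul_mem_wordSpan hx h' (by omega) (by omega)))
    (mul_mem_wordSpan (cube_mem h2 h3 hA x) hZ' (by omega) (by omega))

theorem word_mem_of_three_le_count [DecidableEq M] (h2 : (2 : K) ≠ 0) (h3 : (3 : K) ≠ 0)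
    (hA : ReducesTriples K O δ) {x : M} {w : List M} (hw : 3 ≤ w.count x) :
    (w.map O).prod ∈ wordSpan K O δ (w.map δ).sum (w.length - 1) := by
  obtain ⟨s, t, rfl, hs⟩ := List.eq_append_cons_of_mem
    (List.count_pos_iff.1 (by omega : 0 < w.count x))
  have h1 : 2 ≤ t.count x := by
    rw [List.count_append, List.count_eq_zero_of_not_mem hs, List.count_cons_self] at hw; omega
  obtain ⟨Y, t, rfl, hY⟩ := List.eq_append_cons_of_mem
    (List.count_pos_iff.1 (by omega : 0 < t.count x))
  have h0 : 1 ≤ t.count x := by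
    rw [List.count_append, List.count_eq_zero_of_not_mem hY, List.count_cons_self] at h1; omega
  obtain ⟨Z, t, rfl, -⟩ := List.eq_append_cons_of_mem
    (List.count_pos_iff.1 (by omega : 0 < t.count x))
  have h := mul_mem_wordSpan (prod_mem_wordSpan s le_rfl le_rfl)
    (mul_mem_wordSpan (three_occurrences h2 h3 hA x (prod_mem_wordSpan Y le_rfl le_rfl)
      (prod_mem_wordSpan Z le_rfl le_rfl)) (prod_mem_wordSpan t le_rfl le_rfl) le_rfl le_rfl)
    (D := ((s ++ x :: (Y ++ x :: (Z ++ x :: t))).map δ).sum)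
    (N := (s ++ x :: (Y ++ x :: (Z ++ x :: t))).length - 1)
    (by simp only [List.map_append, List.map_cons, List.sum_append, List.sum_cons]; omega)
    (by simp only [List.length_append, List.length_cons]; omega)
  convert h using 1
  simp only [List.map_append, List.map_cons, List.prod_append, List.prod_cons, mul_assoc]

end ReducesTriples

/-- If every word with a letter of degree at least `n` lies in the subspace `I`, and at most `D`
letters have smaller degree, then all words of degree at least `2 n D` lie in `I`. -/
theorem ReducesTriples.word_mem [DecidableEq M] (h2 : (2 : K) ≠ 0) (h3 : (3 : K) ≠ 0)
    (hA : ReducesTriples K O δ) {n D : ℕ} (hn : 1 ≤ n) (hD : 1 ≤ D)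
    {T : Finset M} (hT : T.card ≤ D)
    (hTn : ∀ x, δ x < n → x ∈ T) {I : Submodule K R}
    (hI : ∀ w : List M, (∃ x ∈ w, n ≤ δ x) → (w.map O).prod ∈ I) (w : List M)
    (hw : 2 * n * D ≤ (w.map δ).sum) : (w.map O).prod ∈ I := by
  obtain ⟨l, hl⟩ : ∃ l, w.length = l := ⟨_, rfl⟩
  induction l using Nat.strong_induction_on generalizing w with
  | _ l ih =>
    by_cases hx : ∃ x ∈ w, n ≤ δ x
    · exact hI w hx
    push Not at hx
    by_cases hc : ∃ x, 3 ≤ w.count x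
    · obtain ⟨x, hx3⟩ := hc
      have hl3 := List.count_le_length (a := x) (l := w)
      have h := ReducesTriples.word_mem_of_three_le_count h2 h3 hA hx3
      refine (Submodule.span_le.2 ?_ : wordSpan K O δ _ _ ≤ I) h
      rintro _ ⟨v, hv, hvd, rfl⟩
      exact ih v.length (by omega) v (by omega) rfl
    -- No further reduction is possible: each of the at most `D` letters occurs at most twice and
    -- has degree at most `n - 1`, so the degree is at most `2 D (n - 1) < 2 n D`.
    push Not at hc
    exfalso
    have hlen : w.length ≤ 2 * D := by
      have h1 : w.length = ∑ x ∈ T, w.count x :=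
        (List.sum_toFinset_count_eq_length w).symm.trans (Finset.sum_subset (fun x hxw =>
          hTn x (hx x (List.mem_toFinset.1 hxw))) fun x _ hxw =>
            List.count_eq_zero_of_not_mem fun h => hxw (List.mem_toFinset.2 h))
      have h2 : ∑ x ∈ T, w.count x ≤ T.card * 2 :=
        Finset.sum_le_card_nsmul _ _ _ fun x _ => Nat.lt_succ_iff.1 (hc x)
      omega
    have hsum : (w.map δ).sum ≤ w.length * (n - 1) := by
      have := List.sum_le_card_nsmul (w.map δ) (n - 1) (by
        intro y hy
        obtain ⟨x, hxw, rfl⟩ := List.mem_map.1 hy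
        have := hx x hxw
        omega)
      simpa using this
    obtain ⟨n, rfl⟩ : ∃ n', n = n' + 1 := ⟨n - 1, by omega⟩
    rw [Nat.add_sub_cancel] at hsum
    nlinarith [Nat.mul_le_mul_right n hlen]

end WordSpan

/-! ### Commutative monomials and their values -/

namespace CommMonomial

variable {X : Type*}

/-- The monomial of a nonassociative word. -/
def mk (p : FreeMagma X) : CommMonomial X := (p : (commCon X).Quotient)

theorem mk_surjective : Function.Surjective (mk : FreeMagma X → CommMonomial X) :=
  Quotient.mk''_surjective

theorem mk_mul (p q : FreeMagma X) : mk (p * q) = mk p * mk q := rfl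

theorem degree_mk (p : FreeMagma X) : (mk p).degree = p.length := rfl

theorem degree_mul (a b : CommMonomial X) : (a * b).degree = a.degree + b.degree := by
  obtain ⟨p, rfl⟩ := mk_surjective a
  obtain ⟨q, rfl⟩ := mk_surjective b
  rfl

theorem degree_pos (a : CommMonomial X) : 0 < a.degree := by
  obtain ⟨p, rfl⟩ := mk_surjective a
  exact p.length_pos

theorem eq_of_commCon {A : Type*} [Mul A] (hA : ∀ a b : A, a * b = b * a) (g : X → A)
    {p q : FreeMagma X} (h : commCon X p q) : FreeMagma.lift g p = FreeMagma.lift g q := by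
  have h' : ConGen.Rel (fun a b => ∃ p q : FreeMagma X, a = p * q ∧ b = q * p) p q := h
  induction h' with
  | of a b hab =>
    obtain ⟨p, q, rfl, rfl⟩ := hab
    rw [map_mul, map_mul, hA]
  | refl a => rfl
  | symm _ ih => exact (ih ‹_›).symm
  | trans _ _ ih₁ ih₂ => exact (ih₁ ‹_›).trans (ih₂ ‹_›)
  | mul _ _ ih₁ ih₂ => rw [map_mul, map_mul, ih₁ ‹_›, ih₂ ‹_›]

/-- The value of a monomial in a commutative algebra. -/
def eval {A : Type*} [NonUnitalNonAssocCommRing A] (g : X → A) : CommMonomial X →ₙ* A where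
  toFun m := Con.liftOn m (FreeMagma.lift g) fun _ _ h => eq_of_commCon mul_comm g h
  map_mul' a b := by
    obtain ⟨p, rfl⟩ := mk_surjective a
    obtain ⟨q, rfl⟩ := mk_surjective b
    exact map_mul (FreeMagma.lift g) p q

theorem eval_mk {A : Type*} [NonUnitalNonAssocCommRing A] (g : X → A) (p : FreeMagma X) :
    eval g (mk p) = FreeMagma.lift g p := rfl

theorem finite_degree_lt [Finite X] (n : ℕ) : {m : CommMonomial X | m.degree < n}.Finite := by
  induction n with
  | zero => simp
  | succ n ih =>
    refine ((Set.finite_range fun i : X => mk (FreeMagma.of i)).union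
      (Set.Finite.image2 (· * ·) ih ih)).subset ?_
    intro m hm
    obtain ⟨p, rfl⟩ := mk_surjective m
    cases p with
    | of i => exact .inl ⟨i, rfl⟩
    | mul p q =>
      have hp := p.length_pos
      have hq := q.length_pos
      change p.length + q.length < n + 1 at hm
      exact .inr ⟨mk p, show p.length < n by omega, mk q, show q.length < n by omega, rfl⟩

end CommMonomial

theorem dimBelow_eq_card (K : Type*) [Field K] (n k : ℕ) :
    dimBelow K n k = (CommMonomial.finite_degree_lt (X := Fin k) n).toFinset.card := by
  have hfin := CommMonomial.finite_degree_lt (X := Fin k) n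
  have : Fintype {m : CommMonomial (Fin k) | m.degree < n} := hfin.fintype
  have h : LinearIndependent K (fun m : {m : CommMonomial (Fin k) | m.degree < n} =>
      (MonoidAlgebra.single m.1 1 : FreeCommAlgebra K (Fin k))) :=
    (MonoidAlgebra.basis (CommMonomial (Fin k)) K).linearIndependent.comp _
      Subtype.val_injective
  rw [dimBelow, Set.image_eq_range, finrank_span_eq_card h, Set.Finite.card_toFinset]

/-! ### Nilpotency and monomials of the free algebra with vanishing cubes -/

namespace FreeCubeZeroAlgebra

variable {K : Type*} {X : Type*} [Field K]

theorem cube_eq_zero (x : FreeCubeZeroAlgebra K X) : x * x * x = 0 := by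
  obtain ⟨x, rfl⟩ := Submodule.Quotient.mk_surjective _ x
  rw [← mk_mul, ← mk_mul, Submodule.Quotient.mk_eq_zero]
  exact Submodule.mem_sInf.2 fun I hI => hI.2 x

variable (K) in
/-- The generators. -/
noncomputable def gen (i : X) : FreeCubeZeroAlgebra K X :=
  Submodule.Quotient.mk (MonoidAlgebra.single (CommMonomial.mk (FreeMagma.of i)) 1)

theorem lift_gen (p : FreeMagma X) : FreeMagma.lift (gen K) p =
    (Submodule.Quotient.mk (MonoidAlgebra.single (CommMonomial.mk p) 1) :
      FreeCubeZeroAlgebra K X) := by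
  induction p with
  | ih1 i => rfl
  | ih2 p q hp hq =>
    rw [map_mul, hp, hq, ← mk_mul, MonoidAlgebra.single_mul_single, mul_one,
      CommMonomial.mk_mul]

theorem adjoin_range_gen :
    NonUnitalAlgebra.adjoin K (Set.range (gen K : X → FreeCubeZeroAlgebra K X)) = ⊤ := by
  refine eq_top_iff.2 fun x _ => ?_
  obtain ⟨x, rfl⟩ := Submodule.Quotient.mk_surjective _ x
  induction x using MonoidAlgebra.induction_linear with
  | zero => exact zero_mem _
  | add a b ha hb => exact add_mem (ha trivial) (hb trivial)
  | single m r =>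
    obtain ⟨p, rfl⟩ := CommMonomial.mk_surjective m
    have e : (MonoidAlgebra.single (CommMonomial.mk p) r : FreeCommAlgebra K X) =
        r • MonoidAlgebra.single (CommMonomial.mk p) 1 := by
      rw [MonoidAlgebra.smul_single, smul_eq_mul, mul_one]
    rw [e, Submodule.Quotient.mk_smul, ← lift_gen]
    refine SMulMemClass.smul_mem r ?_
    clear e
    induction p with
    | ih1 i => exact NonUnitalAlgebra.subset_adjoin K ⟨i, rfl⟩
    | ih2 p q hp hq =>
      rw [map_mul]
      exact mul_mem (hp trivial) (hq trivial)

theorem exists_isNilpotencyIndex [Finite X] (h2 : (2 : K) ≠ 0) (h3 : (3 : K) ≠ 0) :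
    ∃ n, IsNilpotencyIndex (FreeCubeZeroAlgebra K X) n := by
  obtain ⟨N, h1, hN⟩ := exists_productsVanish_of_cube_zero h2 h3 cube_eq_zero
    (adjoin_range_gen (K := K) (X := X))
  obtain ⟨n, -, hn⟩ := _root_.exists_isNilpotencyIndex h1 hN
  exact ⟨n, hn⟩

theorem single_mem_cubeIdeal {n : ℕ} (h : ProductsVanish (FreeCubeZeroAlgebra K X) n)
    {m : CommMonomial X} (hm : n ≤ m.degree) :
    (MonoidAlgebra.single m 1 : FreeCommAlgebra K X) ∈ cubeIdeal K X := by
  obtain ⟨p, rfl⟩ := CommMonomial.mk_surjective m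
  rw [← Submodule.Quotient.mk_eq_zero]
  change (Submodule.Quotient.mk _ : FreeCubeZeroAlgebra K X) = 0
  rw [← lift_gen]
  have hlen (p : FreeMagma X) : (FreeMagma.map (gen K) p).length = p.length := by
    induction p with
    | ih1 i => rfl
    | ih2 p q hp hq => rw [map_mul]; exact congrArg₂ (· + ·) hp hq
  have hlift (p : FreeMagma X) :
      FreeMagma.lift id (FreeMagma.map (gen K) p) = FreeMagma.lift (gen K) p := by
    induction p with
    | ih1 i => rfl
    | ih2 p q hp hq => rw [map_mul, map_mul, map_mul, hp, hq]
  rw [← hlift]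
  exact h _ ((hlen p).symm ▸ hm)

/-- A product has no component at a generator, so the kernel of that coordinate is an ideal
containing all cubes. This ensures `dim[n,k] ≥ 1` when there is a generator. -/
theorem single_of_notMem_cubeIdeal (i : X) :
    (MonoidAlgebra.single (CommMonomial.mk (FreeMagma.of i)) 1 : FreeCommAlgebra K X) ∉
      cubeIdeal K X := by
  classical
  have hmul (a b : FreeCommAlgebra K X) :
      (a * b).coeff (CommMonomial.mk (FreeMagma.of i)) = 0 := by
    induction a using MonoidAlgebra.induction_linear with
    | zero => simp
    | add a a' h h' => rw [add_mul, MonoidAlgebra.coeff_add, Finsupp.add_apply, h, h', add_zero]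
    | single m r =>
      induction b using MonoidAlgebra.induction_linear with
      | zero => simp
      | add b b' h h' => rw [mul_add, MonoidAlgebra.coeff_add, Finsupp.add_apply, h, h', add_zero]
      | single n s =>
        rw [MonoidAlgebra.single_mul_single, MonoidAlgebra.coeff_single]
        refine Finsupp.single_eq_of_ne fun h => ?_
        have h1 := congrArg CommMonomial.degree h
        rw [CommMonomial.degree_mul, CommMonomial.degree_mk] at h1
        have hm := m.degree_pos
        have hn := n.degree_pos
        change 1 = _ at h1
        omega
  intro h
  have h' := Submodule.mem_sInf.1 h
    (LinearMap.ker ((MonoidAlgebra.basis (CommMonomial X) K).coord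
      (CommMonomial.mk (FreeMagma.of i))))
    ⟨fun a x _ => hmul a x, fun x => hmul (x * x) x⟩
  have h1 : (MonoidAlgebra.single (CommMonomial.mk (FreeMagma.of i)) (1 : K) :
    FreeCommAlgebra K X).coeff (CommMonomial.mk (FreeMagma.of i)) = 0 := h'
  rw [MonoidAlgebra.coeff_single, Finsupp.single_eq_same] at h1
  exact one_ne_zero h1

end FreeCubeZeroAlgebra

/-! ### The bound on the nilpotency index and local nilpotency -/

section Bound

set_option linter.unusedSectionVars false

variable {K : Type*} {A : Type*} [Field K] [NonUnitalNonAssocCommRing A] [Module K A]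
  [IsScalarTower K A A] [SMulCommClass K A A]

/-- The preimage of the ideal `cubeSpan K A` under evaluation is one of the subspaces whose infimum
defines `cubeIdeal K X`. -/
theorem eval_mem_cubeSpan (h2 : (2 : K) ≠ 0) (h3 : (3 : K) ≠ 0)
    (h : SatisfiesHalfCubeIdentity K A) {X : Type*} (g : X → A) {m : CommMonomial X}
    (hm : (MonoidAlgebra.single m 1 : FreeCommAlgebra K X) ∈ cubeIdeal K X) :
    CommMonomial.eval g m ∈ cubeSpan K A := by
  let φ : FreeCommAlgebra K X →ₙₐ[K] A := MonoidAlgebra.liftMagma K (CommMonomial.eval g)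
  have e : φ (MonoidAlgebra.single m 1) = CommMonomial.eval g m :=
    DFunLike.congr_fun ((MonoidAlgebra.liftMagma K).symm_apply_apply (CommMonomial.eval g)) m
  rw [← e]
  refine Submodule.mem_sInf.1 hm ((cubeSpan K A).comap (φ : FreeCommAlgebra K X →ₗ[K] A)) ⟨?_, ?_⟩
  · intro a x hx
    change φ (a * x) ∈ cubeSpan K A
    rw [map_mul]
    exact mul_mem_cubeSpan h2 h3 h _ hx
  · intro x
    change φ (x * x * x) ∈ cubeSpan K A
    rw [map_mul, map_mul]
    exact Submodule.subset_span ⟨_, rfl⟩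

/-- Letters are indexed by monomials rather than by elements of `A`, so that `x (y z)` and `y z` are
again letters and degrees add up exactly. -/
theorem reducesTriples_eval (h2 : (2 : K) ≠ 0) (h : SatisfiesHalfCubeIdentity K A) {X : Type*}
    (g : X → A) : ReducesTriples K (fun m => mulOp K (CommMonomial.eval g m))
      (CommMonomial.degree : CommMonomial X → ℕ) := by
  intro x y z
  have e := mul_mul_eq_of_halfCube h2 h (CommMonomial.eval g x) (CommMonomial.eval g y)
    (CommMonomial.eval g z)
  simp only [← map_mul] at e
  have hx := letter_mem_wordSpan (K := K) (δ := CommMonomial.degree)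
    (O := fun m => mulOp K (CommMonomial.eval g m)) x
  have hyz := letter_mem_wordSpan (K := K) (δ := CommMonomial.degree)
    (O := fun m => mulOp K (CommMonomial.eval g m)) (y * z)
  have hxyz := letter_mem_wordSpan (K := K) (δ := CommMonomial.degree)
    (O := fun m => mulOp K (CommMonomial.eval g m)) (x * (y * z))
  have hd := CommMonomial.degree_mul y z
  have hd' := CommMonomial.degree_mul x (y * z)
  have hmem := sub_mem (neg_mem (wordSpan_mono (d' := x.degree + y.degree + z.degree)
      (by omega) (by omega : 1 ≤ 2) hxyz))
    (ReducesTriples.two_mul_mem (mul_mem_wordSpan (D := x.degree + y.degree + z.degree) (N := 2)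
      hx hyz (by omega) (by omega)))
  convert hmem using 1
  simpa only [zsmul_eq_mul, Int.cast_ofNat] using e

variable (K A) in
/-- The operators that map the algebra into the span of the cubes and annihilate that span. -/
def cubeOperators : Submodule K (Module.End K A) where
  carrier := {T | (∀ a, T a ∈ cubeSpan K A) ∧ ∀ c ∈ cubeSpan K A, T c = 0}
  zero_mem' := ⟨fun _ => zero_mem _, fun _ _ => rfl⟩
  add_mem' hS hT := ⟨fun a => add_mem (hS.1 a) (hT.1 a), fun c hc => by
    rw [LinearMap.add_apply, hS.2 c hc, hT.2 c hc, add_zero]⟩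
  smul_mem' r T hT := ⟨fun a => Submodule.smul_mem _ _ (hT.1 a), fun c hc => by
    rw [LinearMap.smul_apply, hT.2 c hc, smul_zero]⟩

/-- The letter from the cube span sends everything into that ideal, and the other letters preserve
it. On the ideal itself this letter acts as zero, since the square of the ideal is zero. -/
theorem word_mem_cubeOperators (h2 : (2 : K) ≠ 0) (h3 : (3 : K) ≠ 0)
    (h : SatisfiesHalfCubeIdentity K A) {M : Type*} (e : M → A) (w : List M)
    (hw : ∃ x ∈ w, e x ∈ cubeSpan K A) :
    (w.map fun m => mulOp K (e m)).prod ∈ cubeOperators K A := by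
  have hword (w : List M) {c : A} (hc : c ∈ cubeSpan K A) :
      (w.map fun m => mulOp K (e m)).prod c ∈ cubeSpan K A := by
    induction w with
    | nil => exact hc
    | cons x w ih => exact mul_mem_cubeSpan h2 h3 h _ ih
  induction w with
  | nil => simp at hw
  | cons y w ih =>
    rw [List.map_cons, List.prod_cons]
    obtain ⟨x, hxw, hx⟩ := hw
    rcases List.mem_cons.1 hxw with rfl | hxw
    · refine ⟨fun a => ?_, fun c hc => cubeSpan_mul_cubeSpan h2 h3 h hx (hword w hc)⟩
      rw [Module.End.mul_apply, LinearMap.mulLeft_apply, mul_comm]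
      exact mul_mem_cubeSpan h2 h3 h _ hx
    · obtain ⟨h1, h1'⟩ := ih ⟨x, hxw, hx⟩
      refine ⟨fun a => mul_mem_cubeSpan h2 h3 h _ (h1 a), fun c hc => ?_⟩
      rw [Module.End.mul_apply, h1' c hc, map_zero]

/-- At each product, turn the shorter factor into an operator and descend into the longer one, whose
degree is at least half. -/
theorem exists_word_of_two_pow_le {X : Type*} (g : X → A) (N : ℕ) (p : FreeMagma X)
    (hp : 2 ^ N ≤ p.length) : ∃ w : List (CommMonomial X), w.length = N ∧ ∃ a : A,
      FreeMagma.lift g p = (w.map fun m => mulOp K (CommMonomial.eval g m)).prod a := by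
  induction N generalizing p with
  | zero => exact ⟨[], rfl, FreeMagma.lift g p, rfl⟩
  | succ N ih =>
    cases p with
    | of i =>
      have : 2 ^ (N + 1) ≤ 1 := hp
      have := Nat.one_lt_two_pow (Nat.succ_ne_zero N)
      omega
    | mul p q =>
      change 2 ^ (N + 1) ≤ p.length + q.length at hp
      rw [pow_succ] at hp
      rcases le_total q.length p.length with h | h
      · obtain ⟨w, hw, a, ha⟩ := ih p (by omega)
        refine ⟨CommMonomial.mk q :: w, by simp [hw], a, ?_⟩
        rw [List.map_cons, List.prod_cons, Module.End.mul_apply, ← ha, LinearMap.mulLeft_apply,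
          CommMonomial.eval_mk, mul_comm]
        rfl
      · obtain ⟨w, hw, a, ha⟩ := ih q (by omega)
        refine ⟨CommMonomial.mk p :: w, by simp [hw], a, ?_⟩
        rw [List.map_cons, List.prod_cons, Module.End.mul_apply, ← ha, LinearMap.mulLeft_apply,
          CommMonomial.eval_mk]
        rfl

theorem one_le_dimBelow {n k : ℕ} (hk : 1 ≤ k)
    (hn : ProductsVanish (FreeCubeZeroAlgebra K (Fin k)) n) : 1 ≤ dimBelow K n k := by
  rw [dimBelow_eq_card, Nat.one_le_iff_ne_zero, Finset.card_ne_zero]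
  refine ⟨CommMonomial.mk (FreeMagma.of ⟨0, hk⟩), ?_⟩
  rw [Set.Finite.mem_toFinset]
  by_contra hlt
  exact FreeCubeZeroAlgebra.single_of_notMem_cubeIdeal _
    (FreeCubeZeroAlgebra.single_mem_cubeIdeal hn (not_lt.1 hlt))

theorem productsVanish_of_halfCube (h2 : (2 : K) ≠ 0) (h3 : (3 : K) ≠ 0)
    (h : SatisfiesHalfCubeIdentity K A) {n k : ℕ}
    (hn : IsNilpotencyIndex (FreeCubeZeroAlgebra K (Fin k)) n) (hA : IsGeneratedBy K A k) :
    ProductsVanish A (2 ^ (4 * n * dimBelow K n k)) := by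
  classical
  obtain ⟨g, hg⟩ := hA
  refine productsVanish_of_degreeSpan hg fun p hp => ?_
  -- Without generators there are no monomials to treat; this case is separate because the reduction
  -- needs `dim[n,k] ≥ 1`.
  rcases Nat.eq_zero_or_pos k with rfl | hk
  · exact FreeMagma.recOnMul (C := fun _ => FreeMagma.lift g p = 0) p (fun i => i.elim0)
      fun _ _ h _ => h
  have hword : ∀ w : List (CommMonomial (Fin k)), 2 * n * dimBelow K n k ≤ w.length →
      (w.map fun m => mulOp K (CommMonomial.eval g m)).prod ∈ cubeOperators K A := by
    intro w hw
    refine (reducesTriples_eval h2 h g).word_mem h2 h3 hn.1.1 (one_le_dimBelow hk hn.1.2)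
      (dimBelow_eq_card K n k).ge (fun m hm => (Set.Finite.mem_toFinset _).2 hm) (fun w hw => ?_) w
      (hw.trans ?_)
    · obtain ⟨x, hxw, hx⟩ := hw
      exact word_mem_cubeOperators h2 h3 h _ w ⟨x, hxw, eval_mem_cubeSpan h2 h3 h g
        (FreeCubeZeroAlgebra.single_mem_cubeIdeal hn.1.2 hx)⟩
    · have := List.length_le_sum_of_one_le (w.map CommMonomial.degree) (by
        intro d hd
        obtain ⟨m, -, rfl⟩ := List.mem_map.1 hd
        exact m.degree_pos)
      simpa using this
  obtain ⟨w, hw, a, ha⟩ := exists_word_of_two_pow_le (K := K) g _ p hp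
  -- The right half of the word maps into the span of the cubes, and the left half annihilates that
  -- span.
  have e : 4 * n * dimBelow K n k = 2 * n * dimBelow K n k + 2 * n * dimBelow K n k := by ring
  rw [ha, ← List.take_append_drop (2 * n * dimBelow K n k) w, List.map_append, List.prod_append,
    Module.End.mul_apply]
  exact (hword _ (by rw [List.length_take]; omega)).2 _
    ((hword _ (by rw [List.length_drop]; omega)).1 a)

theorem isLocallyNilpotentAlgebra_of_halfCube (h2 : (2 : K) ≠ 0) (h3 : (3 : K) ≠ 0)
    (h : SatisfiesHalfCubeIdentity K A) : IsLocallyNilpotentAlgebra K A := by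
  intro s
  let B := NonUnitalAlgebra.adjoin K (s : Set A)
  let _ : NonUnitalNonAssocCommRing B :=
    { (inferInstance : NonUnitalNonAssocRing B) with
      mul_comm := fun a b => Subtype.ext (mul_comm (a : A) b) }
  have hB : SatisfiesHalfCubeIdentity K B := by
    intro x
    ext y
    have := LinearMap.congr_fun (h x) y
    simpa [pow_succ] using this
  let g (i : Fin s.card) : B := ⟨s.equivFin.symm i, NonUnitalAlgebra.subset_adjoin K
    (s.equivFin.symm i).2⟩
  have hg : NonUnitalAlgebra.adjoin K (Set.range g) = ⊤ := by
    refine eq_top_iff.2 ?_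
    rintro ⟨x, hx⟩ -
    induction hx using NonUnitalAlgebra.adjoin_induction with
    | mem x hx =>
      refine NonUnitalAlgebra.subset_adjoin K ⟨s.equivFin ⟨x, hx⟩, ?_⟩
      simp [g]
    | add x y hx hy hx' hy' => exact add_mem hx' hy'
    | zero => exact zero_mem _
    | mul x y hx hy hx' hy' => exact mul_mem hx' hy'
    | smul r x hx hx' => exact SMulMemClass.smul_mem r hx'
  obtain ⟨n, hn⟩ := FreeCubeZeroAlgebra.exists_isNilpotencyIndex (X := Fin s.card) h2 h3
  obtain ⟨m, -, hm⟩ := exists_isNilpotencyIndex Nat.one_le_two_pow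
    (productsVanish_of_halfCube h2 h3 hB hn ⟨g, hg⟩)
  exact ⟨m, hm⟩

end Bound

theorem theorem7 {K : Type u} [Field K] (h2 : ringChar K ≠ 2) (h3 : ringChar K ≠ 3) :
    (∀ (A : Type v) [NonUnitalNonAssocCommRing A] [Module K A] [IsScalarTower K A A]
        [SMulCommClass K A A],
        SatisfiesHalfCubeIdentity K A → IsLocallyNilpotentAlgebra K A) ∧
    (∀ k : ℕ, ∃ n : ℕ, IsNilpotencyIndex (FreeCubeZeroAlgebra K (Fin k)) n ∧
      ∀ (A : Type w) [NonUnitalNonAssocCommRing A] [Module K A] [IsScalarTower K A A]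
        [SMulCommClass K A A],
        SatisfiesHalfCubeIdentity K A → IsGeneratedBy K A k →
          ∃ m : ℕ, m ≤ 2 ^ (4 * n * dimBelow K n k) ∧ IsNilpotencyIndex A m) := by
  have h2' : (2 : K) ≠ 0 := Ring.two_ne_zero h2
  have h3' : (3 : K) ≠ 0 := by
    intro h0
    have h : ringChar K ∣ 3 := (ringChar.spec K 3).1 (by exact_mod_cast h0)
    rcases (Nat.dvd_prime Nat.prime_three).1 h with h1 | h1
    · exact CharP.ringChar_ne_one h1
    · exact h3 h1
  refine ⟨fun A _ _ _ _ h => isLocallyNilpotentAlgebra_of_halfCube h2' h3' h, fun k => ?_⟩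
  obtain ⟨n, hn⟩ := FreeCubeZeroAlgebra.exists_isNilpotencyIndex (X := Fin k) h2' h3'
  exact ⟨n, hn, fun A _ _ _ _ h hA => exists_isNilpotencyIndex Nat.one_le_two_pow
    (productsVanish_of_halfCube h2' h3' h hn hA)⟩
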